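/- Let $k$ be a field and let $X$ be a geometrically irreducible smooth projective (equivalently, smooth proper) curve over $k$. Let $\operatorname{Div}(X)$ be the free abelian group on the closed points of $X$, $\operatorname{Pic}(X)=\operatorname{Div}(X)/\{\operatorname{div}(f) : f\in k(X)^\times\}$, $\deg(\sum_j e_jQ_j)=\sum_j e_j[k(Q_j):k]$, $\operatorname{Div}^0(X)=\ker(\deg)$, and let $\operatorname{Pic}^0(X)$ be the subgroup of $\operatorname{Pic}(X)$ of classes of degree zero and $\operatorname{Pic}(X)_{\mathrm{tors}}$ the torsion subgroup of $\operatorname{Pic}(X)$; principal divisors have degree zero, so $\operatorname{Pic}(X)_{\mathrm{tors}}\subset\operatorname{Pic}^0(X)$. For $f\in k(X)^\times$, a closed point $Q$ (at which uniformizers $\pi\in k(X)^\times$ exist), and $n\in\mathbb Z_{>0}$ with $n\mid\operatorname{ord}_Q(f)$, put $$\operatorname{lc}_Q(f,n)=\Bigl(\frac{f}{\pi^{\operatorname{ord}_Q(f)}}(Q)\Bigr)\otimes\frac1n\in k(Q)^\times\otimes\mathbb Q/\mathbb Z .$$ For $D\in\operatorname{Div}(X)$ with $[D]\in\operatorname{Pic}(X)_{\mathrm{tors}}$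 and $E=\sum_je_jQ_j\in\operatorname{Div}^0(X)$, choose $n\in\mathbb Z_{>0}$ and $f\in k(X)^\times$ with $\operatorname{div}(f)=nD$, and put $$\langle D,E\rangle=\prod_j N_{k(Q_j)/k}\bigl(\operatorname{lc}_{Q_j}(f,n)\bigr)^{e_j}\in k^\times\otimes\mathbb Q/\mathbb Z,$$ where $N_{k(Q_j)/k}$ is induced by the norm of the finite extension $k(Q_j)/k$. Then $\langle D,E\rangle$ depends only on the classes of $D$ and $E$ in $\operatorname{Pic}(X)$; in particular it does not depend on $n$, $f$ or the uniformizers. Consequently there is a unique induced biadditive pairing $$\langle\cdot,\cdot\rangle:\operatorname{Pic}(X)_{\mathrm{tors}}\times\operatorname{Pic}^0(X)\to k^\times\otimes\mathbb Q/\mathbb Z,\qquad \langle[D],[E]\rangle=\langle D,E\rangle .$$ Moreover, its restriction to $\operatorname{Pic}(X)_{\mathrm{tors}}\times\operatorname{Pic}(X)_{\mathrm{tors}}$ is symmetric. -/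

import Mathlib

open CategoryTheory AlgebraicGeometry TopologicalSpace
open scoped TensorProduct

universe u

/-- A standard smooth algebra over a domain is reduced: it is flat over a polynomial ring `P` and its base
change to the fraction field of `P` is étale over a field. -/
theorem isReduced_of_isStandardSmooth {R S : Type u} [CommRing R] [IsDomain R] [CommRing S]
    (f : R →+* S) (hf : f.IsStandardSmooth) : IsReduced S := by
  obtain ⟨n, g, -, hg⟩ := hf.exists_etale_mvPolynomial
  algebraize [g]
  have : Module.Flat (MvPolynomial (Fin n) R) S := inferInstance
  let L := FractionRing (MvPolynomial (Fin n) R)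
  have : IsReduced (L ⊗[MvPolynomial (Fin n) R] S) :=
    Algebra.FormallyUnramified.isReduced_of_field L _
  refine isReduced_of_injective
    (Algebra.TensorProduct.includeRight : S →ₐ[MvPolynomial (Fin n) R] L ⊗[_] S) ?_
  exact Algebra.TensorProduct.includeRight_injective (IsFractionRing.injective _ _)

/-- A smooth proper geometrically irreducible curve over a field `k`
(for curves, "smooth proper" and "smooth projective" are the same). -/
structure SmoothProperCurve (k : Type u) [Field k] where
  /-- The underlying scheme. -/
  X : Scheme.{u}
  /-- The structure morphism. -/
  str : X ⟶ Spec (CommRingCat.of k)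
  smooth : SmoothOfRelativeDimension 1 str
  proper : IsProper str
  geomIrreducible : GeometricallyIrreducible str

namespace SmoothProperCurve

attribute [instance] smooth proper geomIrreducible

variable {k : Type u} [Field k] (C : SmoothProperCurve k)

instance : IsNoetherian C.X where
  toIsLocallyNoetherian := LocallyOfFiniteType.isLocallyNoetherian C.str
  toCompactSpace := QuasiCompact.compactSpace_of_compactSpace C.str

instance : AlgebraicGeometry.IsReduced C.X := by
  have (x : C.X) : _root_.IsReduced (C.X.presheaf.stalk x) := by
    obtain ⟨U, hU, V, hV, hxV, e, h⟩ :=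
      SmoothOfRelativeDimension.exists_isStandardSmoothOfRelativeDimension (n := 1) (f := C.str) x
    have : Nonempty U := ⟨⟨C.str x, e hxV⟩⟩
    have := isReduced_of_isStandardSmooth _ h.isStandardSmooth
    let := TopCat.Presheaf.algebra_section_stalk C.X.presheaf (⟨x, hxV⟩ : V)
    have := hV.isLocalization_stalk ⟨x, hxV⟩
    exact isReduced_localizationPreserves (hV.primeIdealOf ⟨x, hxV⟩).asIdeal.primeCompl _ ‹_›
  exact isReduced_of_isReduced_stalk C.X

instance : IrreducibleSpace C.X :=
  GeometricallyIrreducible.irreducibleSpace_of_subsingleton (f := C.str)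

instance : IsIntegral C.X := isIntegral_of_irreducibleSpace_of_isReduced C.X

/-- The field of rational functions `k(X)`. -/
abbrev RatFunc : Type u := C.X.functionField

/-- The closed points of the curve. -/
abbrev ClosedPoint : Type u := {x : C.X // IsClosed ({x} : Set C.X)}

/-- The residue field `k(Q)` of a closed point. -/
abbrev ResidueField (Q : C.ClosedPoint) : Type u := C.X.residueField Q.1

/-- `k(Q)` is a `k`-algebra through the structure morphism. -/
noncomputable instance (Q : C.ClosedPoint) : Algebra k (C.ResidueField Q) :=
  RingHom.toAlgebra
    ((Scheme.ΓSpecIso (CommRingCat.of k)).inv ≫ C.str.appTop ≫ C.X.Γevaluation Q.1).hom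

/-- The order of vanishing at `Q` of a non-zero rational function. -/
noncomputable def ord (Q : C.ClosedPoint) (f : C.RatFuncˣ) : ℤ := C.X.ord f.1 Q.1

/-- The group of divisors: the free abelian group on the closed points. -/
abbrev Div : Type u := C.ClosedPoint →₀ ℤ

theorem finite_ord_ne_zero (f : C.RatFuncˣ) : {Q : C.ClosedPoint | C.ord Q f ≠ 0}.Finite := by
  obtain ⟨U, -, g, hne, hg, hu⟩ := exists_isUnit_germ_eq C.X f.1 f.ne_zero
  obtain ⟨S, hS, hSc, hSi, hU⟩ :=
    NoetherianSpace.exists_finite_set_isClosed_irreducible (U.isOpen.isClosed_compl)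
  have key : ∀ Q : C.ClosedPoint, C.ord Q f ≠ 0 → ({Q.1} : Set C.X) ∈ S := by
    intro Q hQ
    have h1 : Order.coheight Q.1 = 1 := by
      by_contra h
      exact hQ (Scheme.ord_eq_zero_of_coheight_neq_one h _)
    have hQU : Q.1 ∈ (U : Set C.X)ᶜ := fun h ↦ hQ (by
      rw [ord, ← hg]; exact Scheme.ord_of_isUnit hu h)
    rw [hU] at hQU
    obtain ⟨W, hW, hQW⟩ := hQU
    obtain ⟨w, hw⟩ := QuasiSober.sober (hSi W hW) (hSc W hW)
    have hle : Q.1 ≤ w := hw.specializes hQW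
    have hwU : w ∉ (U : Set C.X) := by
      have : w ∈ (U : Set C.X)ᶜ := hU ▸ Set.mem_sUnion_of_mem hw.mem hW
      exact this
    have hgen : genericPoint C.X ∈ (U : Set C.X) :=
      ((genericPoint_spec C.X).mem_open_set_iff U.isOpen).mpr (by simpa using hne)
    have hwtop : w ≠ ⊤ := fun h ↦ hwU (h ▸ hgen)
    have hQw : Q.1 = w := by
      by_contra hne
      have hlt : Q.1 < w := lt_of_le_not_ge hle fun h ↦
        hne ((show Q.1 ⤳ w from h).antisymm hle).eq
      have h2 := Order.coheight_add_one_le hlt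
      have h3 := Order.coheight_add_one_le 
        (lt_of_le_not_ge (b := (⊤ : C.X)) le_top fun h ↦ hwtop
          ((show w ⤳ (⊤ : C.X) from h).antisymm (genericPoint_specializes w)).eq)
      rw [h1] at h2
      have h4 : (1 : ℕ∞) ≤ Order.coheight w := le_trans (by simp) h3
      have h5 : (1 : ℕ∞) + 1 ≤ 1 := le_trans (by gcongr) h2
      exact absurd h5 (by decide)
    have : W = {Q.1} := by
      rw [← hw, ← hQw, Q.2.closure_eq]
    exact this ▸ hW
  refine Set.Finite.of_finite_image (f := fun Q : C.ClosedPoint ↦ ({Q.1} : Set C.X))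
    (hS.subset ?_) fun Q _ Q' _ h ↦ Subtype.ext (Set.singleton_injective h)
  rintro _ ⟨Q, hQ, rfl⟩
  exact key Q hQ

/-- The divisor `div(f) = ∑ ord_Q(f) Q` of a non-zero rational function. -/
noncomputable def div : Additive C.RatFuncˣ →+ C.Div where
  toFun f := Finsupp.ofSupportFinite (fun Q ↦ C.ord Q f.toMul) (C.finite_ord_ne_zero f.toMul)
  map_zero' := by
    ext Q
    have h := Scheme.ord_mul (X := C.X) (x := Q.1) one_ne_zero one_ne_zero
    rw [mul_one] at h
    change C.X.ord 1 Q.1 = 0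
    lia
  map_add' f g := by
    ext Q
    exact Scheme.ord_mul f.toMul.ne_zero g.toMul.ne_zero

/-- The Picard group: divisors modulo principal divisors. -/
abbrev Pic : Type u := C.Div ⧸ C.div.range

/-- The class `[D]` of a divisor `D`. -/
noncomputable def divClass : C.Div →+ C.Pic := QuotientAddGroup.mk' C.div.range

/-- The degree `deg(∑ e_j Q_j) = ∑ e_j [k(Q_j) : k]` of a divisor. -/
noncomputable def deg : C.Div →+ ℤ :=
  Finsupp.liftAddHom fun Q ↦ AddMonoidHom.mulRight (Module.finrank k (C.ResidueField Q) : ℤ)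

/-- The subgroup `Div⁰(X)` of divisors of degree zero. -/
noncomputable def Div0 : AddSubgroup C.Div := C.deg.ker

/-- The subgroup `Pic⁰(X)` of the classes of divisors of degree zero. (As principal divisors have
degree zero, this is the kernel of the degree map on the Picard group.) -/
noncomputable def Pic0 : AddSubgroup C.Pic := C.Div0.map C.divClass

/-- The torsion subgroup of the Picard group. -/
noncomputable def PicTors : AddSubgroup C.Pic := AddCommGroup.torsion C.Pic

/-- `π` is a uniformizer at `Q`. -/
def IsUniformizer (Q : C.ClosedPoint) (π : C.RatFuncˣ) : Prop := C.ord Q π = 1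

open Classical in
/-- The value `g(Q) ∈ k(Q)ˣ` of a rational function `g` that is a unit of the local ring at `Q`
(and `1` for all other `g`). -/
noncomputable def valueAt (Q : C.ClosedPoint) (g : C.RatFuncˣ) : (C.ResidueField Q)ˣ :=
  if h : ∃ v : (C.X.presheaf.stalk Q.1)ˣ, algebraMap (C.X.presheaf.stalk Q.1) C.RatFunc v = g then
    Units.map (C.X.residue Q.1).hom.toMonoidHom h.choose
  else 1

end SmoothProperCurve

/-- The group `ℚ/ℤ`. -/
abbrev QModZ : Type := ℚ ⧸ AddSubgroup.zmultiples (1 : ℚ)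

/-- The group `Fˣ ⊗ ℚ/ℤ`, written additively. -/
abbrev UnitsQModZ (F : Type u) [Field F] : Type u := Additive Fˣ ⊗[ℤ] QModZ

namespace SmoothProperCurve

variable {k : Type u} [Field k] (C : SmoothProperCurve k)

/-- The leading coefficient
`lc_Q(f, n) = (f / π ^ ord_Q(f))(Q) ⊗ 1/n ∈ k(Q)ˣ ⊗ ℚ/ℤ`, computed with the uniformizer `π`. -/
noncomputable def lc (Q : C.ClosedPoint) (π f : C.RatFuncˣ) (n : ℕ) :
    UnitsQModZ (C.ResidueField Q) :=
  Additive.ofMul (C.valueAt Q (f / π ^ C.ord Q f)) ⊗ₜ[ℤ] (((n : ℚ)⁻¹ : ℚ) : QModZ)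

/-- The map `k(Q)ˣ ⊗ ℚ/ℤ → kˣ ⊗ ℚ/ℤ` induced by the norm of `k(Q)/k`. -/
noncomputable def normMap (Q : C.ClosedPoint) :
    UnitsQModZ (C.ResidueField Q) →+ UnitsQModZ k :=
  (LinearMap.rTensor QModZ
    (Units.map (Algebra.norm k : C.ResidueField Q →* k)).toAdditive.toIntLinearMap).toAddMonoidHom

/-- The expression `∏ N_{k(Q_j)/k}(lc_{Q_j}(f, n)) ^ e_j` (written additively) for
`E = ∑ e_j Q_j`, computed with the uniformizers `π Q_j`. -/
noncomputable def pairingExpr (π : C.ClosedPoint → C.RatFuncˣ) (n : ℕ) (f : C.RatFuncˣ)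
    (E : C.Div) : UnitsQModZ k :=
  E.sum fun Q e ↦ e • C.normMap Q (C.lc Q (π Q) f n)

/-- `B` is induced by the leading coefficient expression: `B([D], [E])` is its value for all
divisors `D` with torsion class and `E` of degree zero, for all `n > 0` and `f` with `div(f) = nD`,
and for all choices of uniformizers. -/
def IsInducedPairing (B : C.PicTors →+ C.Pic0 →+ UnitsQModZ k) : Prop :=
  ∀ (D E : C.Div) (hD : C.divClass D ∈ C.PicTors) (hE : E ∈ C.Div0)
    (n : ℕ) (f : C.RatFuncˣ) (π : C.ClosedPoint → C.RatFuncˣ),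
    0 < n → C.div (Additive.ofMul f) = n • D → (∀ Q, C.IsUniformizer Q (π Q)) →
      B ⟨C.divClass D, hD⟩ ⟨C.divClass E, AddSubgroup.mem_map_of_mem C.divClass hE⟩ =
        C.pairingExpr π n f E

end SmoothProperCurve

/-!
The pairing is well defined and symmetric because of Weil reciprocity `f(div g) = g(div f)`, where
`f(∑ e_j Q_j) = ∏ N(f(Q_j)) ^ e_j` (`evalDiv`). Only functions `f` and `g` with disjoint divisors
are needed: replacing `f` by `f * h ^ n` replaces `D` by `D + div h` and changes no leading
coefficient, as `u ^ n ⊗ 1/n = 0`, and by weak approximation (`exists_ord_eq`) `h` can be chosen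
such that `D + div h` avoids a given finite set of points. After this move the pairing is
`f(E) ⊗ 1/n`. Independence of `n`, `f` and `D` then reduces to a function without zeros and poles,
which is algebraic over `k` and has the value `1` on divisors of degree zero
(`evalDiv_eq_one_of_div_eq_zero`); for `E = div g` one has `f(div g) = g(n D) = g(D) ^ n`; and if
`div f = n D` and `div g = n E`, then `f(E) ⊗ 1/n = f(div g) ⊗ 1/n² = g(div f) ⊗ 1/n² = g(D) ⊗ 1/n`.

Weil reciprocity (`evalDiv_div_comm`) is first proved when `g = t` is separating, that is, when the
function field `K` is finite separable over `k(t)`. Let `B` be the integral closure of `k[t]` in `K`,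
a Dedekind domain that is free of finite rank over `k[t]`. Its maximal ideals are the closed points
at which `t` is regular (`ofPrime`, by the valuative criterion), with the same orders and residue
fields. For `f ∈ B` with norm `P ∈ k[t]`, the value of `f` on the zeros of `t` is the norm of `f` on
`B / t`, which is `P(0)`; the value of `t` on the zeros of `f` is the norm of `t` on `B / f`, which
is `± P(0) / lc(P)` by the Smith normal form. Doing the same for `t⁻¹`, and comparing at `t = ∞` the
two expressions of the norm of `f` to `k(t)`, gives reciprocity (`IsSeparating.evalDiv_div`); the
ranks give that `div t` has degree zero. The general case follows since a derivation of `K` over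
`k` does not vanish at some separating `x`, and every function at which it does not vanish is
separating: any `g` is a quotient `(g * u) / u` of two such functions, with `div u` disjoint from a
given divisor.
-/

open Polynomial IntermediateField

/-! ### Étale algebras over the affine line -/

section EtaleOverLine

theorem algebraMap_injective_of_etale (k S : Type*) [Field k] [CommRing S] [IsDomain S]
    [Algebra k[X] S] [Algebra.Etale k[X] S] : Function.Injective (algebraMap k[X] S) :=
  FaithfulSMul.algebraMap_injective k[X] S

/-- An étale algebra over the affine line is not finite over the ground field, so its closed points
are not generic. -/
theorem ne_bot_of_isMaximal_of_etale (k : Type*) {S : Type*} [Field k] [CommRing S] [IsDomain S]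
    [Algebra k S] [Algebra k[X] S] [IsScalarTower k k[X] S] [Algebra.Etale k[X] S]
    (q : Ideal S) [q.IsMaximal] : q ≠ ⊥ := by
  rintro rfl
  have hS : IsField S := by
    by_contra h
    obtain ⟨I, hI, hI'⟩ := (Ring.not_isField_iff_exists_ideal_bot_lt_and_lt_top).mp h
    exact hI'.ne ((Ideal.isMaximal_def.mp ‹(⊥ : Ideal S).IsMaximal›).2 I hI)
  let := hS.toField
  have : Algebra.FiniteType k S := Algebra.FiniteType.trans (S := k[X]) inferInstance inferInstance
  have : Module.Finite k S := finite_of_finite_type_of_isJacobsonRing k S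
  have h1 : IsIntegral k (algebraMap k[X] S X) := Algebra.IsIntegral.isIntegral _
  have h2 : IsIntegral k (X : k[X]) := by
    refine (isIntegral_algHom_iff (IsScalarTower.toAlgHom k k[X] S) ?_).mp h1
    exact algebraMap_injective_of_etale k S
  exact transcendental_X k h2.isAlgebraic

/-- A point of an étale cover of the affine line has a discrete valuation ring as its local ring:
its maximal ideal is generated by that of the point below. -/
theorem isDiscreteValuationRing_of_etale (k : Type*) {S : Type*} [Field k] [CommRing S] [IsDomain S]
    [Algebra k S] [Algebra k[X] S] [IsScalarTower k k[X] S] [Algebra.Etale k[X] S]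
    (q : Ideal S) [q.IsMaximal] (O : Type*) [CommRing O]
    [IsDomain O] [Algebra S O] [IsLocalization.AtPrime O q] : IsDiscreteValuationRing O := by
  have hq : q ≠ ⊥ := ne_bot_of_isMaximal_of_etale k q
  have : IsNoetherianRing S := Algebra.FiniteType.isNoetherianRing k[X] S
  let p := q.under k[X]
  let := Localization.AtPrime.algebraOfLiesOver p q
  have hm := ((Algebra.isUnramifiedAt_iff_map_eq k[X] p q).mp inferInstance).2
  have : IsNoetherianRing (Localization.AtPrime q) :=
    IsLocalization.isNoetherianRing q.primeCompl _ inferInstance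
  have hdvr : IsDiscreteValuationRing (Localization.AtPrime q) := by
    refine ((IsDiscreteValuationRing.TFAE (Localization.AtPrime q)
      (IsLocalization.AtPrime.not_isField S hq (Localization.AtPrime q))).out 4 0).mp ?_
    rw [← hm, ← Submodule.IsPrincipal.span_singleton_generator p]
    change Submodule.IsPrincipal (Ideal.map _ (Ideal.span _))
    rw [Ideal.map_span, Set.image_singleton]
    exact ⟨_, rfl⟩
  exact IsDiscreteValuationRing.RingEquivClass.isDiscreteValuationRing
    (IsLocalization.algEquiv q.primeCompl (Localization.AtPrime q) O)

/-- The function field of an étale cover of the affine line is finite separable over `k(x)`. -/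
theorem finite_separable_of_etale (k : Type*) {S : Type*} [Field k] [CommRing S] [IsDomain S]
    [Algebra k S] [Algebra k[X] S] [IsScalarTower k k[X] S] [Algebra.Etale k[X] S]
    (K : Type*) [Field K] [Algebra k K] [Algebra S K]
    [IsScalarTower k S K] [IsFractionRing S K] :
    Transcendental k (algebraMap S K (algebraMap k[X] S X)) ∧
    Module.Finite k⟮algebraMap S K (algebraMap k[X] S X)⟯ K ∧
    Algebra.IsSeparable k⟮algebraMap S K (algebraMap k[X] S X)⟯ K := by
  set x := algebraMap S K (algebraMap k[X] S X) with hx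
  have hinj : Function.Injective ((algebraMap S K).comp (algebraMap k[X] S)) :=
    (IsFractionRing.injective S K).comp (algebraMap_injective_of_etale k S)
  have hae : ((algebraMap S K).comp (algebraMap k[X] S)) = (aeval x : k[X] →ₐ[k] K).toRingHom := by
    ext a
    · have : C a = algebraMap k k[X] a := rfl
      simp [this, ← IsScalarTower.algebraMap_apply]
    · simp [hx]
  have htr : Transcendental k x := by
    rw [transcendental_iff_injective]
    have := hae ▸ hinj
    exact this
  let : Algebra k[X] K := ((algebraMap S K).comp (algebraMap k[X] S)).toAlgebra
  have : IsScalarTower k[X] S K := .of_algebraMap_eq' rfl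
  let : Algebra k[X] k⟮x⟯ := (aeval (⟨x, mem_adjoin_simple_self k x⟩ : k⟮x⟯)).toRingHom.toAlgebra
  have : IsScalarTower k[X] k⟮x⟯ K := by
    refine .of_algebraMap_eq' (hae.trans ?_)
    ext a
    · simp [RingHom.algebraMap_toAlgebra]
    · simp [RingHom.algebraMap_toAlgebra]
  have : Algebra.EssFiniteType S K := .of_isLocalization _ (nonZeroDivisors S)
  have : Algebra.EssFiniteType k[X] K := .comp k[X] S K
  have : Algebra.FormallyUnramified S K := .of_isLocalization (nonZeroDivisors S)
  have : Algebra.FormallyUnramified k[X] K := .comp k[X] S K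
  have : Algebra.FormallyUnramified k⟮x⟯ K := .of_restrictScalars k[X] _ _
  have : Algebra.EssFiniteType k⟮x⟯ K := .of_comp k[X] _ _
  exact ⟨htr, Algebra.FormallyUnramified.finite_of_free _ _,
    Algebra.FormallyUnramified.isSeparable _ _⟩

end EtaleOverLine

/-- An element `t` of an extension field is separating if it is transcendental and the extension is finite
separable over `k(t)`. -/
def IsSeparating (k : Type*) {K : Type*} [Field k] [Field K] [Algebra k K] (t : K) : Prop :=
  Transcendental k t ∧ Module.Finite k⟮t⟯ K ∧ Algebra.IsSeparable k⟮t⟯ K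

/-! ### The ground field, local rings and separating functions -/

namespace SmoothProperCurve
variable {k : Type u} [Field k] (C : SmoothProperCurve k)

/-- The inclusion of the constants in the global functions. -/
noncomputable def constants : k →+* Γ(C.X, ⊤) :=
  ((Scheme.ΓSpecIso (CommRingCat.of k)).inv ≫ C.str.appTop).hom

/-- The local rings of the curve, and its function field, are algebras over the ground field. -/
noncomputable instance (x : C.X) : Algebra k (C.X.presheaf.stalk x) :=
  ((C.X.presheaf.germ ⊤ x (Opens.mem_top x)).hom.comp C.constants).toAlgebra

noncomputable instance : Algebra k C.RatFunc :=
  inferInstanceAs (Algebra k (C.X.presheaf.stalk (genericPoint C.X)))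

noncomputable instance (Q : C.ClosedPoint) :
    Algebra (C.X.presheaf.stalk Q.1) (C.ResidueField Q) :=
  (C.X.residue Q.1).hom.toAlgebra

instance (Q : C.ClosedPoint) : IsScalarTower k (C.X.presheaf.stalk Q.1) (C.ResidueField Q) :=
  .of_algebraMap_eq' rfl

instance (x : C.X) : IsScalarTower k (C.X.presheaf.stalk x) C.RatFunc := by
  have : Nonempty (⊤ : C.X.Opens) := ⟨⟨x, Opens.mem_top x⟩⟩
  refine .of_algebraMap_eq fun a => ?_
  change C.X.presheaf.germ ⊤ _ (Opens.mem_top _) (C.constants a) =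
    algebraMap (C.X.presheaf.stalk x) C.X.functionField
      (C.X.presheaf.germ ⊤ x (Opens.mem_top x) (C.constants a))
  rw [Scheme.algebraMap_germ_eq_germToFunctionField]

/-- Smoothness of relative dimension one: locally, the curve is étale over the affine line. -/
theorem exists_etale_chart (x : C.X) : ∃ (V : C.X.Opens) (_ : IsAffineOpen V) (_ : x ∈ V)
    (g : k[X] →+* Γ(C.X, V)), g.Etale ∧
      g.comp Polynomial.C = (C.X.presheaf.map (homOfLE le_top).op).hom.comp C.constants := by
  obtain ⟨U, hU, V, hV, hxV, e, h⟩ :=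
    SmoothOfRelativeDimension.exists_isStandardSmoothOfRelativeDimension (n := 1) (f := C.str) x
  obtain rfl : U = ⊤ := by
    ext y
    have : y = C.str x := Subsingleton.elim _ _
    exact ⟨fun _ => trivial, fun _ => this ▸ e hxV⟩
  have h' : ((Scheme.ΓSpecIso (CommRingCat.of k)).inv ≫
      C.str.appLE ⊤ V e).hom.IsStandardSmoothOfRelativeDimension 1 := by
    rw [CommRingCat.hom_comp]
    exact (RingHom.isStandardSmoothOfRelativeDimension_respectsIso (n := 1)).2 _
      (Scheme.ΓSpecIso (CommRingCat.of k)).symm.commRingCatIsoToRingEquiv h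
  obtain ⟨g, hgC, hg⟩ := h'.exists_etale_mvPolynomial
  let ε : k[X] ≃ₐ[k] MvPolynomial (Fin 1) k := (MvPolynomial.uniqueAlgEquiv k (Fin 1)).symm
  refine ⟨V, hV, hxV, g.comp ε.toRingEquiv.toRingHom, ?_, ?_⟩
  · exact RingHom.Etale.respectsIso.2 _ ε.toRingEquiv hg
  · ext a
    have h1 : ε (Polynomial.C a) = MvPolynomial.C a := ε.commutes a
    have h2 := congr($hgC a)
    change g (ε (Polynomial.C a)) = _
    rw [h1]
    refine h2.trans ?_
    have h3 : C.str.appTop ≫ C.X.presheaf.map (homOfLE le_top).op =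
        C.str.appLE ⊤ V e := rfl
    rw [← h3]
    rfl

/-- The local ring at a closed point of the curve is a discrete valuation ring. -/
instance (Q : C.ClosedPoint) : IsDiscreteValuationRing (C.X.presheaf.stalk Q.1) := by
  obtain ⟨V, hV, hQV, g, hg, hgC⟩ := C.exists_etale_chart Q.1
  have : Nonempty V := ⟨⟨_, hQV⟩⟩
  let : Algebra k Γ(C.X, V) := (g.comp Polynomial.C).toAlgebra
  let : Algebra k[X] Γ(C.X, V) := g.toAlgebra
  have : Algebra.Etale k[X] Γ(C.X, V) := hg
  have : IsScalarTower k k[X] Γ(C.X, V) := .of_algebraMap_eq' rfl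
  have := hV.primeIdealOf_isMaximal_of_isClosed ⟨Q.1, hQV⟩ Q.2
  let := TopCat.Presheaf.algebra_section_stalk C.X.presheaf (⟨Q.1, hQV⟩ : V)
  have := hV.isLocalization_stalk ⟨Q.1, hQV⟩
  exact isDiscreteValuationRing_of_etale k (hV.primeIdealOf ⟨Q.1, hQV⟩).asIdeal _

/-- The coordinate of an étale chart is a separating function. -/
theorem exists_isSeparating : ∃ t : C.RatFunc, IsSeparating k t := by
  obtain ⟨V, hV, hQV, g, hg, hgC⟩ := C.exists_etale_chart (genericPoint C.X)
  have : Nonempty V := ⟨⟨_, hQV⟩⟩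
  let : Algebra k Γ(C.X, V) := (g.comp Polynomial.C).toAlgebra
  let : Algebra k[X] Γ(C.X, V) := g.toAlgebra
  have : Algebra.Etale k[X] Γ(C.X, V) := hg
  have : IsScalarTower k k[X] Γ(C.X, V) := .of_algebraMap_eq' rfl
  have := functionField_isFractionRing_of_isAffineOpen C.X V hV
  have : IsScalarTower k Γ(C.X, V) C.RatFunc := by
    refine .of_algebraMap_eq fun a => ?_
    change C.X.presheaf.germ ⊤ _ (Opens.mem_top _) (C.constants a) =
      C.X.germToFunctionField V (g (Polynomial.C a))
    have := congr($hgC a)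
    simp only [RingHom.comp_apply] at this
    rw [this]
    exact (TopCat.Presheaf.germ_res_apply ..).symm
  exact ⟨_, finite_separable_of_etale k (S := Γ(C.X, V)) C.RatFunc⟩

end SmoothProperCurve

/-! ### Closed points and valuation rings of the function field -/

namespace SmoothProperCurve
variable {k : Type u} [Field k] (C : SmoothProperCurve k)

theorem fromSpecStalk_str (x : C.X) :
    C.X.fromSpecStalk x ≫ C.str =
      Spec.map (CommRingCat.ofHom (algebraMap k (C.X.presheaf.stalk x))) := by
  have h : C.str = C.X.toSpecΓ ≫ Spec.map (CommRingCat.ofHom C.constants) := by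
    have h1 := Scheme.toSpecΓ_naturality C.str
    have h2 : CommRingCat.ofHom C.constants =
      (Scheme.ΓSpecIso (CommRingCat.of k)).inv ≫ C.str.appTop := rfl
    rw [h2, Spec.map_comp, ← Category.assoc, ← h1, Category.assoc, ← SpecMap_ΓSpecIso_hom,
      ← Spec.map_comp, Iso.inv_hom_id, Spec.map_id, Category.comp_id]
  rw [h, Scheme.fromSpecStalk_toSpecΓ_assoc, ← Spec.map_comp]
  rfl

/-- The local ring at a closed point, as a valuation ring of the function field. -/
noncomputable def valRing (Q : C.ClosedPoint) : ValuationSubring C.RatFunc where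
  __ := (algebraMap (C.X.presheaf.stalk Q.1) C.RatFunc).range
  mem_or_inv_mem' f := ValuationRing.isInteger_or_isInteger (C.X.presheaf.stalk Q.1) f

theorem algebraMap_mem_valRing (Q : C.ClosedPoint) (c : k) :
    algebraMap k C.RatFunc c ∈ C.valRing Q :=
  ⟨algebraMap k _ c, (IsScalarTower.algebraMap_apply ..).symm⟩

/-- A valuation ring that contains a discrete valuation ring is equal to it or trivial. -/
theorem eq_valRing_of_valRing_le {Q : C.ClosedPoint} {V : ValuationSubring C.RatFunc}
    (h : C.valRing Q ≤ V) (hV : V ≠ ⊤) : V = C.valRing Q := by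
  refine le_antisymm (fun f hf => ?_) h
  by_contra hfQ
  obtain ⟨ϖ, hϖ⟩ := IsDiscreteValuationRing.exists_irreducible (C.X.presheaf.stalk Q.1)
  have hϖ0 : algebraMap _ C.RatFunc ϖ ≠ 0 := by
    simpa using hϖ.ne_zero
  -- the inverse of `f` lies in the maximal ideal, so that `f⁻¹ = ϖ * a` and `ϖ⁻¹ = a * f ∈ V`
  have hinv : (algebraMap _ C.RatFunc ϖ)⁻¹ ∈ V := by
    obtain ⟨a, ha⟩ := ((C.valRing Q).mem_or_inv_mem f).resolve_left hfQ
    have hf0 : f ≠ 0 := by rintro rfl; exact hfQ (C.valRing Q).zero_mem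
    have ha' : ¬ IsUnit a := fun hu => hfQ ⟨hu.unit⁻¹.1, by
      rw [← inv_inv f, ← ha, map_units_inv, IsUnit.unit_spec]⟩
    obtain ⟨b, rfl⟩ : ϖ ∣ a := by
      rw [← Ideal.mem_span_singleton, ← hϖ.maximalIdeal_eq]
      exact ha'
    have : (algebraMap _ C.RatFunc ϖ)⁻¹ = algebraMap _ C.RatFunc b * f := by
      rw [map_mul] at ha
      field_simp
      rw [ha, inv_mul_cancel₀ hf0]
    rw [this]
    exact V.mul_mem _ _ (h ⟨b, rfl⟩) hf
  refine hV (top_le_iff.mp fun g _ => ?_)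
  obtain ⟨a, b, hb, rfl⟩ := IsFractionRing.div_surjective (A := C.X.presheaf.stalk Q.1) g
  obtain ⟨n, u, rfl⟩ := IsDiscreteValuationRing.eq_unit_mul_pow_irreducible
    (nonZeroDivisors.ne_zero hb) hϖ
  rw [div_eq_mul_inv, map_mul, mul_inv, map_pow, ← inv_pow]
  refine V.mul_mem _ _ (h ⟨a, rfl⟩) (V.mul_mem _ _ (h ⟨(u⁻¹ : _ˣ).1, ?_⟩) (pow_mem hinv n))
  exact map_units_inv _ u

/-- By the valuative criterion, every non-trivial valuation ring of the function field over the
ground field is the local ring at a closed point. -/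
theorem exists_valRing_eq (V : ValuationSubring C.RatFunc)
    (hk : ∀ c : k, algebraMap k C.RatFunc c ∈ V) (hV : V ≠ ⊤) : ∃ Q, C.valRing Q = V := by
  let j : k →+* V := (algebraMap k C.RatFunc).codRestrict V.toSubring hk
  have hprop : IsProper C.str := inferInstance
  rw [IsProper.eq_valuativeCriterion] at hprop
  let S : ValuativeCommSq C.str :=
    { R := V
      K := C.RatFunc
      i₁ := C.X.fromSpecStalk (genericPoint C.X)
      i₂ := Spec.map (CommRingCat.ofHom j)
      commSq := ⟨by
        rw [C.fromSpecStalk_str, ← Spec.map_comp]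
        rfl⟩ }
  obtain ⟨⟨l, hl, -⟩⟩ := (hprop.1.1.1.existence S).exists_lift
  let x := l (IsLocalRing.closedPoint V)
  obtain ⟨y, hy, hyc⟩ := (isClosed_closure (s := {x})).exists_closed_singleton
    (closure_nonempty_iff.mpr ⟨x, rfl⟩)
  have hxy : x ⤳ y := specializes_iff_mem_closure.mpr hy
  refine ⟨⟨y, hyc⟩, (C.eq_valRing_of_valRing_le (Q := ⟨y, hyc⟩) ?_ hV).symm⟩
  let φ : C.X.presheaf.stalk y ⟶ CommRingCat.of V :=
    C.X.presheaf.stalkSpecializes hxy ≫ Scheme.stalkClosedPointTo l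
  have hφ : Spec.map φ ≫ C.X.fromSpecStalk y = l := by
    rw [Spec.map_comp, Category.assoc, Scheme.SpecMap_stalkSpecializes_fromSpecStalk,
      Scheme.Spec_stalkClosedPointTo_fromSpecStalk]
  have h1 : φ ≫ CommRingCat.ofHom (algebraMap V C.RatFunc) =
      C.X.presheaf.stalkSpecializes ((genericPoint_spec C.X).specializes trivial) := by
    apply Spec.map_injective
    rw [← cancel_mono (C.X.fromSpecStalk y), Spec.map_comp, Category.assoc, hφ,
      Scheme.SpecMap_stalkSpecializes_fromSpecStalk]
    exact hl
  rintro _ ⟨a, rfl⟩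
  have h2 := congr($h1 a)
  change _ ∈ V
  have h3 : algebraMap (C.X.presheaf.stalk y) C.RatFunc a = (φ a : V) := h2.symm
  rw [h3]
  exact (φ a).2

/-- By the valuative criterion, a closed point is determined by its local ring. -/
theorem valRing_injective : Function.Injective C.valRing := by
  intro Q Q' h
  have hprop : IsProper C.str := inferInstance
  rw [IsProper.eq_valuativeCriterion] at hprop
  let V := C.valRing Q
  let j : k →+* V := (algebraMap k C.RatFunc).codRestrict V.toSubring (C.algebraMap_mem_valRing Q)
  let S : ValuativeCommSq C.str :=
    { R := V
      K := C.RatFunc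
      i₁ := C.X.fromSpecStalk (genericPoint C.X)
      i₂ := Spec.map (CommRingCat.ofHom j)
      commSq := ⟨by
        rw [C.fromSpecStalk_str, ← Spec.map_comp]
        rfl⟩ }
  have key : ∀ P : C.ClosedPoint, V = C.valRing P → ∃ l : S.commSq.LiftStruct,
      l.l (IsLocalRing.closedPoint V) = P.1 := by
    intro P hP
    let φ : C.X.presheaf.stalk P.1 →+* V :=
      (algebraMap (C.X.presheaf.stalk P.1) C.RatFunc).codRestrict V.toSubring
        (fun a => hP ▸ ⟨a, rfl⟩)
    have hsurj : Function.Surjective φ := by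
      rintro ⟨f, hf⟩
      obtain ⟨a, ha⟩ : f ∈ C.valRing P := hP ▸ hf
      exact ⟨a, Subtype.ext ha⟩
    have : IsLocalHom φ := .of_surjective φ hsurj
    refine ⟨⟨Spec.map (CommRingCat.ofHom φ) ≫ C.X.fromSpecStalk P.1, ?_, ?_⟩, ?_⟩
    · rw [← Category.assoc, ← Spec.map_comp]
      exact Scheme.SpecMap_stalkSpecializes_fromSpecStalk
        ((genericPoint_spec C.X).specializes trivial)
    · rw [Category.assoc, C.fromSpecStalk_str, ← Spec.map_comp]
      have : φ.comp (algebraMap k (C.X.presheaf.stalk P.1)) = j := RingHom.ext fun c =>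
        Subtype.ext (IsScalarTower.algebraMap_apply k (C.X.presheaf.stalk P.1) C.RatFunc c).symm
      rw [← CommRingCat.ofHom_comp, this]
    · have h4 : Spec.map (CommRingCat.ofHom φ) (IsLocalRing.closedPoint V) =
        IsLocalRing.closedPoint _ := IsLocalRing.comap_closedPoint φ
      exact (Scheme.Hom.comp_apply (Spec.map (CommRingCat.ofHom φ)) (C.X.fromSpecStalk P.1) _).trans
        ((congrArg _ h4).trans Scheme.fromSpecStalk_closedPoint)
  obtain ⟨l, hl⟩ := key Q rfl
  obtain ⟨l', hl'⟩ := key Q' h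
  have := hprop.1.1.1.uniqueness S
  rw [Subsingleton.elim l' l] at hl'
  exact Subtype.ext (hl.symm.trans hl')

end SmoothProperCurve

/-! ### Norms on quotients of Dedekind domains -/

section Determinants

/-- Determinants of endomorphisms are multiplicative in short exact sequences. -/
theorem LinearMap.det_of_exact {k V₁ V₂ V₃ : Type*} [Field k] [AddCommGroup V₁] [AddCommGroup V₂]
    [AddCommGroup V₃] [Module k V₁] [Module k V₂] [Module k V₃] [Module.Finite k V₂]
    {i : V₁ →ₗ[k] V₂} {q : V₂ →ₗ[k] V₃} (hi : Function.Injective i) (hq : Function.Surjective q)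
    (hiq : Function.Exact i q) {e₁ : V₁ →ₗ[k] V₁} {e₂ : V₂ →ₗ[k] V₂} {e₃ : V₃ →ₗ[k] V₃}
    (h₁ : ∀ x, i (e₁ x) = e₂ (i x)) (h₃ : ∀ x, q (e₂ x) = e₃ (q x)) :
    LinearMap.det e₂ = LinearMap.det e₁ * LinearMap.det e₃ := by
  have hW : LinearMap.range i ≤ (LinearMap.range i).comap e₂ := by
    rintro _ ⟨x, rfl⟩
    exact ⟨e₁ x, h₁ x⟩
  rw [LinearMap.det_eq_det_mul_det (LinearMap.range i) e₂ hW]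
  congr 1
  · rw [← LinearMap.det_conj e₁ (LinearEquiv.ofInjective i hi)]
    congr 1
    ext ⟨_, x, rfl⟩
    have : (LinearEquiv.ofInjective i hi).symm ⟨i x, x, rfl⟩ = x := by
      rw [LinearEquiv.symm_apply_eq]; rfl
    simp only [LinearMap.comp_apply, LinearEquiv.coe_coe]
    rw [this]
    exact (h₁ x).symm
  · have hk : LinearMap.range i = LinearMap.ker q := (LinearMap.exact_iff.mp hiq).symm
    rw [← LinearMap.det_conj _ ((Submodule.quotEquivOfEq _ _ hk).trans
      (q.quotKerEquivOfSurjective hq))]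
    congr 1
    ext y
    obtain ⟨x, rfl⟩ := hq y
    have : ((Submodule.quotEquivOfEq _ _ hk).trans (q.quotKerEquivOfSurjective hq)).symm (q x) =
        (LinearMap.range i).mkQ x := by
      rw [LinearEquiv.symm_apply_eq]; rfl
    simp only [LinearMap.comp_apply, LinearEquiv.coe_coe]
    rw [this]
    exact h₃ x

theorem LinearMap.det_piMap {k ι : Type*} [Field k] [Fintype ι] (V : ι → Type*)
    [∀ i, AddCommGroup (V i)] [∀ i, Module k (V i)] [∀ i, Module.Finite k (V i)]
    (e : ∀ i, V i →ₗ[k] V i) :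
    LinearMap.det (LinearMap.piMap e) = ∏ i, LinearMap.det (e i) := by
  classical
  let := LinearOrder.lift' (Fintype.equivFin ι) (Fintype.equivFin ι).injective
  let b := fun i => Module.Free.chooseBasis k (V i)
  let B := Pi.basis b
  have hM : LinearMap.toMatrix B B (LinearMap.piMap e) =
      Matrix.blockDiagonal' (fun i => LinearMap.toMatrix (b i) (b i) (e i)) := by
    ext ⟨i, x⟩ ⟨j, y⟩
    rw [LinearMap.toMatrix_apply, Pi.basis_repr, Pi.basis_apply]
    obtain rfl | h := eq_or_ne i j
    · rw [Matrix.blockDiagonal'_apply_eq]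
      simp [LinearMap.toMatrix_apply]
    · rw [Matrix.blockDiagonal'_apply_ne _ _ _ h]
      simp [Pi.single_eq_of_ne h]
  rw [← LinearMap.det_toMatrix B, hM,
    (Matrix.blockTriangular_blockDiagonal' _).det_fintype]
  refine Finset.prod_congr rfl fun i _ => ?_
  rw [← LinearMap.det_toMatrix (b i),
    ← Matrix.det_submatrix_equiv_self
      (Equiv.sigmaSubtype (β := fun i => Module.Free.ChooseBasisIndex k (V i)) i).symm]
  congr 1
  ext x y
  exact Matrix.blockDiagonal'_apply_eq (fun i => LinearMap.toMatrix (b i) (b i) (e i)) i x y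

variable {k B : Type*} [Field k] [CommRing B] [Algebra k B]

/-- For a maximal ideal `p` of a Dedekind domain, `J / pJ` is isomorphic to the residue field
`B / p`; so there is an exact sequence `0 → B / p → B / pJ → B / J → 0`. -/
theorem Ideal.exists_exact_quotient_mul [IsDedekindDomain B] {p J : Ideal B} (hp : p.IsMaximal)
    (hJ : J ≠ ⊥) :
    ∃ (i : (B ⧸ p) →ₗ[B] (B ⧸ p * J)) (q : (B ⧸ p * J) →ₗ[B] (B ⧸ J)), Function.Injective i ∧
      Function.Surjective q ∧ Function.Exact i q := by
  have hlt : p * J < J := lt_of_le_of_ne Ideal.mul_le_right fun h =>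
    hp.ne_top (mul_right_cancel₀ hJ (h.trans (Ideal.top_mul J).symm))
  obtain ⟨a, haJ, ha⟩ := Set.exists_of_ssubset hlt
  let i₀ := LinearMap.toSpanSingleton B (B ⧸ p * J) (Ideal.Quotient.mk _ a)
  have hi₀ (b : B) : i₀ b = Ideal.Quotient.mk (p * J) (b * a) := by
    simp [i₀, LinearMap.toSpanSingleton_apply, Algebra.smul_def]
  have hle : p ≤ LinearMap.ker i₀ := fun b hb => by
    rw [LinearMap.mem_ker, hi₀, Ideal.Quotient.eq_zero_iff_mem]
    exact Ideal.mul_mem_mul hb haJ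
  have hker : LinearMap.ker i₀ = p := by
    refine (hp.eq_of_le (fun h => ha ?_) hle).symm
    have : (1 : B) ∈ LinearMap.ker i₀ := (h : LinearMap.ker i₀ = ⊤) ▸ Submodule.mem_top
    rwa [LinearMap.mem_ker, hi₀, Ideal.Quotient.eq_zero_iff_mem, one_mul] at this
  refine ⟨Submodule.liftQ p i₀ hle, (Ideal.Quotient.factorₐ B Ideal.mul_le_right).toLinearMap,
    ?_, Ideal.Quotient.factor_surjective Ideal.mul_le_right, ?_⟩
  · rw [← LinearMap.ker_eq_bot, Submodule.ker_liftQ_eq_bot _ _ _ hker.le]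
  · intro y
    obtain ⟨y, rfl⟩ := Ideal.Quotient.mk_surjective y
    -- the ideal generated by `a` and `pJ` is `J`, as there is no ideal strictly between
    have hsup : p * J ⊔ Ideal.span {a} = J := by
      obtain ⟨I, hI⟩ : J ∣ p * J ⊔ Ideal.span {a} :=
        Ideal.dvd_iff_le.mpr (sup_le hlt.le ((Ideal.span_singleton_le_iff_mem _).mpr haJ))
      have hpI : p ≤ I := by
        rw [← Ideal.dvd_iff_le]
        refine (mul_dvd_mul_iff_left hJ).mp ?_
        rw [← hI, Ideal.dvd_iff_le, mul_comm J p]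
        exact le_sup_left
      by_cases hIt : I = ⊤
      · rw [hI, hIt, Ideal.mul_top]
      · rw [← hp.eq_of_le hIt hpI, mul_comm J p] at hI
        exact absurd (hI ▸ (le_sup_right : _ ≤ p * J ⊔ Ideal.span {a})
          (Ideal.mem_span_singleton_self a)) ha
    have h1 : (Ideal.Quotient.factorₐ B (Ideal.mul_le_right : p * J ≤ J)).toLinearMap
        (Ideal.Quotient.mk _ y) = 0 ↔ y ∈ J :=
      Ideal.Quotient.eq_zero_iff_mem
    rw [h1]
    constructor
    · intro hy
      rw [← hsup] at hy
      obtain ⟨z, hz, w, hw, rfl⟩ := Submodule.mem_sup.mp hy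
      obtain ⟨c, rfl⟩ := Ideal.mem_span_singleton'.mp hw
      refine ⟨Ideal.Quotient.mk p c, (hi₀ c).trans ?_⟩
      rw [map_add, Ideal.Quotient.eq_zero_iff_mem.mpr hz, zero_add]
    · rintro ⟨c, hc⟩
      obtain ⟨c, rfl⟩ := Ideal.Quotient.mk_surjective c
      have h2 : Ideal.Quotient.mk (p * J) (c * a) = Ideal.Quotient.mk _ y := (hi₀ c).symm.trans hc
      have := hlt.le (Ideal.Quotient.eq.mp h2)
      simpa using J.sub_mem (J.mul_mem_left c haJ) this

theorem Ideal.norm_quotient_mul [IsDedekindDomain B] {p J : Ideal B} (hp : p.IsMaximal)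
    (hJ : J ≠ ⊥) [Module.Finite k (B ⧸ p * J)] (f : B) :
    Algebra.norm k (Ideal.Quotient.mk (p * J) f) =
      Algebra.norm k (Ideal.Quotient.mk p f) * Algebra.norm k (Ideal.Quotient.mk J f) := by
  obtain ⟨i, q, hi, hq, hex⟩ := Ideal.exists_exact_quotient_mul hp hJ
  refine LinearMap.det_of_exact (i := i.restrictScalars k)
    (q := q.restrictScalars k) hi hq hex (fun x => ?_) (fun x => ?_)
  · change i (Ideal.Quotient.mk p f * x) = Ideal.Quotient.mk (p * J) f * i x
    exact i.map_smul f x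
  · change q (Ideal.Quotient.mk (p * J) f * x) = Ideal.Quotient.mk J f * q x
    exact q.map_smul f x

theorem Ideal.finrank_quotient_mul [IsDedekindDomain B] {p J : Ideal B} (hp : p.IsMaximal)
    (hJ : J ≠ ⊥) [Module.Finite k (B ⧸ p * J)] :
    Module.finrank k (B ⧸ p * J) = Module.finrank k (B ⧸ p) + Module.finrank k (B ⧸ J) := by
  obtain ⟨i, q, hi, hq, hex⟩ := Ideal.exists_exact_quotient_mul hp hJ
  have := LinearMap.finrank_range_add_finrank_ker (q.restrictScalars k)
  have h1 : Function.Exact (i.restrictScalars k) (q.restrictScalars k) := hex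
  rw [LinearMap.exact_iff.mp h1, LinearMap.finrank_range_of_inj (f := i.restrictScalars k) hi,
    (LinearMap.range_eq_top (f := q.restrictScalars k)).mpr hq, finrank_top] at this
  lia

open UniqueFactorizationMonoid in
theorem Ideal.normalizedFactors_prime_mul [IsDedekindDomain B] {p J : Ideal B}
    (hp : Prime p) (hJ : J ≠ ⊥) :
    normalizedFactors (p * J) = p ::ₘ normalizedFactors J := by
  rw [normalizedFactors_mul hp.ne_zero hJ, normalizedFactors_irreducible hp.irreducible,
    normalize_eq, Multiset.singleton_add]

open UniqueFactorizationMonoid in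
/-- The determinant of the multiplication by `f` on `B / I` is the product of the norms of the
values of `f` at the primes of `I`, with multiplicity. -/
theorem Ideal.norm_quotient_eq_prod [IsDedekindDomain B] (f : B) (I : Ideal B) (hI : I ≠ ⊥)
    [hfin : Module.Finite k (B ⧸ I)] :
    Algebra.norm k (Ideal.Quotient.mk I f) = ((normalizedFactors I).map
      fun p => Algebra.norm k (Ideal.Quotient.mk p f)).prod := by
  revert hI hfin
  refine UniqueFactorizationMonoid.induction_on_prime I (fun h => absurd rfl h) ?_ ?_
  · intro I hI _ _
    obtain rfl : I = ⊤ := Ideal.isUnit_iff.mp hI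
    have : Subsingleton (B ⧸ (⊤ : Ideal B)) := Ideal.Quotient.subsingleton_iff.mpr rfl
    rw [Subsingleton.elim (Ideal.Quotient.mk ⊤ f) 1, map_one, ← Ideal.one_eq_top,
      normalizedFactors_one, Multiset.map_zero, Multiset.prod_zero]
  · intro J p hJ hp ih _ _
    have hpm : p.IsMaximal := (Ideal.isPrime_of_prime hp).isMaximal hp.ne_zero
    have : Module.Finite k (B ⧸ J) := Module.Finite.of_surjective
      (Ideal.Quotient.factorₐ k (Ideal.mul_le_right : p * J ≤ J)).toLinearMap
      (Ideal.Quotient.factor_surjective Ideal.mul_le_right)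
    rw [Ideal.normalizedFactors_prime_mul hp hJ, Multiset.map_cons, Multiset.prod_cons,
      ← ih hJ, Ideal.norm_quotient_mul hpm hJ]

open UniqueFactorizationMonoid in
theorem Ideal.finrank_quotient_eq_sum_normalizedFactors [IsDedekindDomain B] (I : Ideal B) (hI : I ≠ ⊥)
    [hfin : Module.Finite k (B ⧸ I)] :
    Module.finrank k (B ⧸ I) = ((normalizedFactors I).map
      fun p => Module.finrank k (B ⧸ p)).sum := by
  revert hI hfin
  refine UniqueFactorizationMonoid.induction_on_prime I (fun h => absurd rfl h) ?_ ?_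
  · intro I hI _ _
    obtain rfl : I = ⊤ := Ideal.isUnit_iff.mp hI
    have : Subsingleton (B ⧸ (⊤ : Ideal B)) := Ideal.Quotient.subsingleton_iff.mpr rfl
    rw [Module.finrank_zero_of_subsingleton, ← Ideal.one_eq_top,
      normalizedFactors_one, Multiset.map_zero, Multiset.sum_zero]
  · intro J p hJ hp ih _ _
    have hpm : p.IsMaximal := (Ideal.isPrime_of_prime hp).isMaximal hp.ne_zero
    have : Module.Finite k (B ⧸ J) := Module.Finite.of_surjective
      (Ideal.Quotient.factorₐ k (Ideal.mul_le_right : p * J ≤ J)).toLinearMap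
      (Ideal.Quotient.factor_surjective Ideal.mul_le_right)
    rw [Ideal.normalizedFactors_prime_mul hp hJ, Multiset.map_cons, Multiset.sum_cons,
      ← ih hJ, Ideal.finrank_quotient_mul hpm hJ]

end Determinants

/-! ### Norms of algebras over a polynomial ring -/

section PolynomialNorm

variable {k B : Type*} [Field k] [CommRing B] [Algebra k B] [Algebra k[X] B]
  [IsScalarTower k k[X] B]

/-- Modulo `X`, a polynomial acts by its constant term. -/
theorem Ideal.Quotient.mk_smul_eq_eval_smul (p : k[X]) (z : B) :
    Ideal.Quotient.mk (Ideal.span {algebraMap k[X] B X}) (p • z) =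
      p.eval 0 • Ideal.Quotient.mk (Ideal.span {algebraMap k[X] B X}) z := by
  have h : p = Polynomial.C (p.eval 0) + X * p.divX := by
    rw [← coeff_zero_eq_eval_zero, add_comm, X_mul_divX_add]
  have h2 : algebraMap k[X] B p = algebraMap k B (p.eval 0) +
      algebraMap k[X] B X * algebraMap k[X] B p.divX := by
    conv_lhs => rw [h]
    rw [map_add, map_mul, IsScalarTower.algebraMap_apply k k[X] B]
    rfl
  rw [Algebra.smul_def, h2, add_mul, map_add, ← Algebra.smul_def, mul_assoc,
    Ideal.Quotient.eq_zero_iff_mem.mpr (Ideal.mul_mem_right _ _ (Ideal.mem_span_singleton_self _)),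
    add_zero]
  rfl

/-- The basis of the fibre at `0` induced by a basis of an algebra over `k[X]`. -/
noncomputable def Module.Basis.quotientX {ι : Type*} [Fintype ι] (b : Module.Basis ι k[X] B) :
    Module.Basis ι k (B ⧸ Ideal.span {algebraMap k[X] B X}) :=
  Module.Basis.mk (v := fun i => Ideal.Quotient.mk (Ideal.span {algebraMap k[X] B X}) (b i)) (by
    rw [Fintype.linearIndependent_iff]
    intro c hc i
    have h1 : Ideal.Quotient.mk (Ideal.span {algebraMap k[X] B X})
        (∑ i, Polynomial.C (c i) • b i) = 0 := by
      rw [map_sum, ← hc]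
      exact Finset.sum_congr rfl fun i _ => by
        rw [Ideal.Quotient.mk_smul_eq_eval_smul, eval_C]
    rw [Ideal.Quotient.eq_zero_iff_mem, Ideal.mem_span_singleton'] at h1
    obtain ⟨w, hw⟩ := h1
    have h2 := congr(b.repr $hw i)
    rw [mul_comm, ← Algebra.smul_def, b.repr_sum_self, map_smul] at h2
    simpa using congr(eval 0 $h2).symm) (by
    intro y _
    obtain ⟨z, rfl⟩ := Ideal.Quotient.mk_surjective y
    rw [← b.sum_repr z, map_sum]
    refine Submodule.sum_mem _ fun i _ => ?_
    rw [Ideal.Quotient.mk_smul_eq_eval_smul]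
    exact Submodule.smul_mem _ _ (Submodule.subset_span ⟨i, rfl⟩))

theorem Module.Basis.quotientX_apply {ι : Type*} [Fintype ι] (b : Module.Basis ι k[X] B) (i : ι) :
    b.quotientX i = Ideal.Quotient.mk (Ideal.span {algebraMap k[X] B X}) (b i) :=
  Module.Basis.mk_apply ..

theorem Module.Basis.quotientX_repr {ι : Type*} [Fintype ι] (b : Module.Basis ι k[X] B) (z : B)
    (i : ι) : b.quotientX.repr (Ideal.Quotient.mk (Ideal.span {algebraMap k[X] B X}) z) i =
      (b.repr z i).eval 0 := by
  have h2 : Ideal.Quotient.mk (Ideal.span {algebraMap k[X] B X}) z =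
      ∑ j, (b.repr z j).eval 0 • b.quotientX j := by
    conv_lhs => rw [← b.sum_repr z, map_sum]
    exact Finset.sum_congr rfl fun j _ => by
      rw [Ideal.Quotient.mk_smul_eq_eval_smul, Module.Basis.quotientX_apply]
  rw [h2, b.quotientX.repr_sum_self]

/-- The norm of an algebra over `k[X]` specializes to the norm of the fibre at `0`. -/
theorem Algebra.norm_quotientX [Module.Free k[X] B] [Module.Finite k[X] B] (f : B) :
    Algebra.norm k (Ideal.Quotient.mk (Ideal.span {algebraMap k[X] B X}) f) =
      (Algebra.norm k[X] f).eval 0 := by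
  classical
  let b := Module.Free.chooseBasis k[X] B
  rw [Algebra.norm_eq_matrix_det b, Algebra.norm_eq_matrix_det b.quotientX, ← coe_evalRingHom,
    RingHom.map_det]
  congr 1
  ext i j
  rw [Algebra.leftMulMatrix_eq_repr_mul, Module.Basis.quotientX_apply, ← map_mul,
    Module.Basis.quotientX_repr]
  simp [Algebra.leftMulMatrix_eq_repr_mul]

theorem finrank_quotientX [Module.Free k[X] B] [Module.Finite k[X] B] :
    Module.finrank k (B ⧸ Ideal.span {algebraMap k[X] B X}) = Module.finrank k[X] B := by
  rw [Module.finrank_eq_card_basis (Module.Free.chooseBasis k[X] B),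
    Module.finrank_eq_card_basis (Module.Free.chooseBasis k[X] B).quotientX]

/-- The multiplication by `X` on `k[X] / a` has the characteristic polynomial `a`, up to a constant. -/
theorem det_X_quotient_span {a : k[X]} (ha : a ≠ 0) :
    LinearMap.det ((LinearMap.lsmul k[X] (k[X] ⧸ Ideal.span {a}) X).restrictScalars k) =
      (-1) ^ a.natDegree * (a.eval 0 / a.leadingCoeff) := by
  have h := Algebra.PowerBasis.norm_gen_eq_coeff_zero_minpoly (AdjoinRoot.powerBasis ha)
  rw [AdjoinRoot.minpoly_powerBasis_gen ha, AdjoinRoot.powerBasis_dim, mul_coeff_zero, coeff_C_zero,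
    ← div_eq_mul_inv, coeff_zero_eq_eval_zero] at h
  rw [← h]
  change _ = LinearMap.det _
  congr 1

/-- The determinant of `X` on `B / f` in terms of the norm of `f`. By the Smith normal form, `B / f`
is a product of quotients `k[X] / aᵢ`, where `∏ aᵢ` is the norm of `f` up to a constant. -/
theorem Algebra.norm_X_quotient_span [IsDomain B] [Module.Free k[X] B] [Module.Finite k[X] B]
    {f : B} (hf : f ≠ 0) :
    Algebra.norm k (Ideal.Quotient.mk (Ideal.span {f}) (algebraMap k[X] B X)) =
      (-1) ^ (Algebra.norm k[X] f).natDegree *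
        ((Algebra.norm k[X] f).eval 0 / (Algebra.norm k[X] f).leadingCoeff) := by
  have hI : Ideal.span {f} ≠ ⊥ := by simpa using hf
  let b := Module.Free.chooseBasis k[X] B
  let a := Ideal.smithCoeffs b _ hI
  have ha (i) : a i ≠ 0 := Ideal.smithCoeffs_ne_zero b _ hI i
  obtain ⟨u, hu⟩ := associated_norm_prod_smith b hf
  obtain ⟨c, hc, hcu⟩ := Polynomial.isUnit_iff.mp u.isUnit
  let e := Ideal.quotientEquivPiSpan (Ideal.span {f}) b hI
  have hfin (i) : Module.Finite k (k[X] ⧸ Ideal.span {a i}) :=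
    (AdjoinRoot.powerBasis (ha i)).finite
  have h1 : Algebra.norm k (Ideal.Quotient.mk (Ideal.span {f}) (algebraMap k[X] B X)) =
      ∏ i, LinearMap.det
        ((LinearMap.lsmul k[X] (k[X] ⧸ Ideal.span {a i}) X).restrictScalars k) := by
    let e' : (B ⧸ Ideal.span {f}) ≃ₗ[k] ∀ i, k[X] ⧸ Ideal.span {a i} := e.restrictScalars k
    rw [← LinearMap.det_piMap, ← LinearMap.det_conj (LinearMap.piMap _) e'.symm]
    refine congrArg LinearMap.det (LinearMap.ext fun x => e'.injective ?_)
    change e (Ideal.Quotient.mk (Ideal.span {f}) (algebraMap k[X] B X) * x) = e (e.symm _)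
    have h3 : Ideal.Quotient.mk (Ideal.span {f}) (algebraMap k[X] B X) * x = (X : k[X]) • x := by
      obtain ⟨x, rfl⟩ := Ideal.Quotient.mk_surjective x
      rw [← map_mul, ← Algebra.smul_def]
      rfl
    rw [h3, map_smul, LinearEquiv.apply_symm_apply]
    rfl
  rw [h1, Finset.prod_congr rfl fun i _ => det_X_quotient_span (ha i), Finset.prod_mul_distrib,
    Finset.prod_div_distrib, Finset.prod_pow_eq_pow_sum]
  have h2 : (∏ i, a i) = Algebra.norm k[X] f * Polynomial.C c := by rw [hcu, hu]
  have hc0 : c ≠ 0 := hc.ne_zero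
  have hN : Algebra.norm k[X] f ≠ 0 := Algebra.norm_ne_zero_iff.mpr hf
  rw [← natDegree_prod _ _ fun i _ => ha i, ← leadingCoeff_prod, ← eval_prod, h2,
    natDegree_mul_C hc0]
  simp only [eval_mul, eval_C, leadingCoeff_mul, leadingCoeff_C]
  rw [mul_div_mul_right _ _ hc0]

end PolynomialNorm

/-! ### Separating elements and derivations -/

section Separating

variable {k K : Type*} [Field k] [Field K] [Algebra k K]

/-- Substitution of `t` makes a field an algebra over the polynomial ring. -/
noncomputable abbrev aevalAlgebra (t : K) : Algebra k[X] K := (aeval (R := k) t).toRingHom.toAlgebra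

/-- Substitution of `t` makes `k(t)` an algebra over the polynomial ring. -/
noncomputable abbrev aevalAdjoinAlgebra (t : K) : Algebra k[X] k⟮t⟯ :=
  (aeval (R := k) (⟨t, mem_adjoin_simple_self k t⟩ : k⟮t⟯)).toRingHom.toAlgebra

theorem aevalAdjoinAlgebra_isScalarTower (t : K) :
    letI := aevalAdjoinAlgebra (k := k) t
    letI := aevalAlgebra (k := k) t
    IsScalarTower k[X] k⟮t⟯ K := by
  let := aevalAdjoinAlgebra (k := k) t
  let := aevalAlgebra (k := k) t
  refine .of_algebraMap_eq' ?_
  ext a <;> simp [RingHom.algebraMap_toAlgebra]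

theorem aevalAlgebra_isScalarTower (t : K) :
    letI := aevalAlgebra (k := k) t
    IsScalarTower k k[X] K := by
  let := aevalAlgebra (k := k) t
  refine .of_algebraMap_eq fun a => ?_
  simp [RingHom.algebraMap_toAlgebra]

theorem aevalAdjoinAlgebra_isScalarTower' (t : K) :
    letI := aevalAdjoinAlgebra (k := k) t
    IsScalarTower k k[X] k⟮t⟯ := by
  let := aevalAdjoinAlgebra (k := k) t
  refine .of_algebraMap_eq fun a => ?_
  simp [RingHom.algebraMap_toAlgebra]

theorem aevalAdjoinAlgebra_isFractionRing {t : K} (ht : Transcendental k t) :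
    letI := aevalAdjoinAlgebra (k := k) t
    IsFractionRing k[X] k⟮t⟯ := by
  let := aevalAdjoinAlgebra (k := k) t
  let := aevalAlgebra (k := k) t
  have := aevalAdjoinAlgebra_isScalarTower (k := k) t
  have : FaithfulSMul k[X] k⟮t⟯ := by
    rw [faithfulSMul_iff_algebraMap_injective]
    have h := transcendental_iff_injective.mp ht
    have h2 : Function.Injective (algebraMap k[X] K) := h
    rw [IsScalarTower.algebraMap_eq k[X] k⟮t⟯ K] at h2
    exact Function.Injective.of_comp (f := algebraMap k⟮t⟯ K) h2
  refine IsFractionRing.of_field k[X] k⟮t⟯ fun z => ?_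
  obtain ⟨p, q, h⟩ := (mem_adjoin_simple_iff k _).mp z.2
  refine ⟨p, q, Subtype.ext ?_⟩
  have h3 (p : k[X]) : ((algebraMap k[X] k⟮t⟯ p : k⟮t⟯) : K) = aeval t p :=
    (IsScalarTower.algebraMap_apply k[X] k⟮t⟯ K p).symm
  rw [h]
  push_cast
  rw [h3, h3]

theorem IsSeparating.formallyEtale {t : K} (ht : IsSeparating k t) :
    letI := aevalAlgebra (k := k) t
    Algebra.FormallyEtale k[X] K := by
  let := aevalAdjoinAlgebra (k := k) t
  let := aevalAlgebra (k := k) t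
  have := aevalAdjoinAlgebra_isScalarTower (k := k) t
  obtain ⟨ht, _, _⟩ := ht
  have := aevalAdjoinAlgebra_isFractionRing ht
  have : Algebra.FormallyEtale k[X] k⟮t⟯ := .of_isLocalization (nonZeroDivisors k[X])
  have : Algebra.FormallyEtale k⟮t⟯ K := .of_isSeparable _ _
  exact .comp k[X] k⟮t⟯ K

theorem IsSeparating.essFiniteType {t : K} (ht : IsSeparating k t) :
    Algebra.EssFiniteType k K := by
  let := aevalAdjoinAlgebra (k := k) t
  obtain ⟨ht, _, _⟩ := ht
  have := aevalAdjoinAlgebra_isFractionRing ht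
  have := aevalAdjoinAlgebra_isScalarTower' (k := k) t
  have : Algebra.EssFiniteType k[X] k⟮t⟯ := .of_isLocalization _ (nonZeroDivisors k[X])
  have : Algebra.EssFiniteType k k⟮t⟯ := .comp k k[X] k⟮t⟯
  exact .comp k k⟮t⟯ K

/-- The differential of a separating element is not zero, since the field is formally étale over the
polynomial ring; so some derivation does not vanish there. -/
theorem IsSeparating.exists_derivation {t : K} (ht : IsSeparating k t) :
    ∃ D : Derivation k K K, D t ≠ 0 := by
  let := aevalAlgebra (k := k) t
  have := aevalAlgebra_isScalarTower (k := k) t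
  have := ht.formallyEtale
  have hX : KaehlerDifferential.D k K t ≠ 0 := by
    intro h
    have h1 := KaehlerDifferential.tensorKaehlerEquivOfFormallyEtale_symm_D_algebraMap k k[X] K X
    have h2 : algebraMap k[X] K X = t := by simp [RingHom.algebraMap_toAlgebra]
    rw [h2, h, map_zero] at h1
    have h3 := congr(TensorProduct.rid k[X] K
      ((KaehlerDifferential.polynomialEquiv k).toLinearMap.lTensor K $h1))
    simp [KaehlerDifferential.polynomialEquiv_D] at h3
  obtain ⟨φ, hφ⟩ := Module.Projective.exists_dual_ne_zero K hX
  exact ⟨φ.compDer (KaehlerDifferential.D k K), hφ⟩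

/-- A derivation of a finite separable extension of `k(x)` is determined by its value at `x`. -/
theorem IsSeparating.derivation_eq_zero {x : K} (hx : IsSeparating k x)
    {D : Derivation k K K} (hD : D x = 0) : D = 0 := by
  obtain ⟨-, _, _⟩ := hx
  have h0 : ∀ a ∈ k⟮x⟯, D a = 0 := by
    intro a ha
    induction ha using IntermediateField.adjoin_induction with
    | mem y hy => rw [Set.mem_singleton_iff.mp hy, hD]
    | algebraMap c => exact D.map_algebraMap c
    | add a b _ _ h1 h2 => rw [map_add, h1, h2, add_zero]
    | inv a _ h => rw [D.leibniz_inv, h, smul_zero]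
    | mul a b _ _ h1 h2 => rw [D.leibniz, h1, h2, smul_zero, smul_zero, add_zero]
  let D' : Derivation k⟮x⟯ K K := Derivation.mk'
    { toFun := D
      map_add' := D.map_add
      map_smul' := fun c a => by
        rw [Algebra.smul_def, D.leibniz, show D (algebraMap k⟮x⟯ K c) = 0 from h0 _ c.2,
          smul_zero, add_zero]
        rfl } D.leibniz
  have : Algebra.FormallyUnramified k⟮x⟯ K := .of_isSeparable _ _
  have : Subsingleton (Ω[K⁄k⟮x⟯]) := inferInstance
  ext a
  change D' a = 0
  rw [← D'.liftKaehlerDifferential_comp_D, Subsingleton.elim (KaehlerDifferential.D k⟮x⟯ K a) 0,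
    map_zero]

/-- A rational function at which some derivation does not vanish is separating. -/
theorem IsSeparating.of_derivation {x : K} (hx : IsSeparating k x) (D : Derivation k K K)
    {t : K} (ht : D t ≠ 0) : IsSeparating k t := by
  have hDx : D x ≠ 0 := fun h => ht (by rw [hx.derivation_eq_zero h]; rfl)
  have := hx.essFiniteType
  have : Algebra.EssFiniteType k⟮t⟯ K := .of_comp k _ _
  have : Algebra.FormallyUnramified k⟮t⟯ K := by
    rw [Algebra.formallyUnramified_iff]
    refine subsingleton_of_forall_eq 0 fun ω => ?_
    by_contra hω
    obtain ⟨φ, hφ⟩ := Module.Projective.exists_dual_ne_zero K hω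
    -- derivations over `k(t)` are multiples of `D` that vanish at `t`, and so they are zero
    let D₁ := φ.compDer (KaehlerDifferential.D k⟮t⟯ K)
    let D₂ : Derivation k K K := D₁.restrictScalars k
    have h1 : D₂ - (D₂ x / D x) • D = 0 := hx.derivation_eq_zero (by simp [hDx])
    have h2 : D₂ t = 0 := D₁.map_algebraMap (⟨t, mem_adjoin_simple_self k t⟩ : k⟮t⟯)
    have h3 : D₂ x = 0 := by
      have := congr($h1 t)
      simpa [h2, ht, hDx] using this
    have h4 : D₁ = 0 := by
      ext a
      have h5 := hx.derivation_eq_zero h3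
      exact congr($h5 a)
    refine hφ ?_
    have h6 : φ = 0 :=
      (KaehlerDifferential.linearMapEquivDerivation k⟮t⟯ K).injective (h4.trans (map_zero _).symm)
    rw [h6]; rfl
  have hfin : Module.Finite k⟮t⟯ K := Algebra.FormallyUnramified.finite_of_free _ _
  refine ⟨fun halg => hx.1 ?_, hfin, Algebra.FormallyUnramified.isSeparable _ _⟩
  have : Module.Finite k k⟮t⟯ := adjoin.finiteDimensional halg.isIntegral
  have : Module.Finite k K := .trans k⟮t⟯ K
  exact Algebra.IsAlgebraic.isAlgebraic x

end Separating

/-! ### Orders and values at closed points -/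

namespace SmoothProperCurve
variable {k : Type u} [Field k] (C : SmoothProperCurve k)

theorem coheight_eq_one (Q : C.ClosedPoint) : Order.coheight Q.1 = 1 := by
  have h := ringKrullDim_stalk_eq_coheight Q.1
  rw [IsDiscreteValuationRing.ringKrullDim_eq_one] at h
  exact_mod_cast h.symm

variable {C} {Q : C.ClosedPoint}

theorem ord_eq_iff {f : C.RatFuncˣ} {n : ℤ} :
    C.ord Q f = n ↔ Ring.ordFrac (C.X.presheaf.stalk Q.1) f.1 = WithZero.exp n :=
  Scheme.ord_eq_iff (C.coheight_eq_one Q) f.ne_zero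

theorem ordFrac_eq_exp_ord (Q : C.ClosedPoint) (f : C.RatFuncˣ) :
    Ring.ordFrac (C.X.presheaf.stalk Q.1) f.1 = WithZero.exp (C.ord Q f) :=
  ord_eq_iff.mp rfl

theorem div_apply (f : C.RatFuncˣ) (Q : C.ClosedPoint) :
    C.div (Additive.ofMul f) Q = C.ord Q f := rfl

theorem ord_mul (Q : C.ClosedPoint) (f g : C.RatFuncˣ) :
    C.ord Q (f * g) = C.ord Q f + C.ord Q g :=
  Scheme.ord_mul f.ne_zero g.ne_zero

theorem ord_one (Q : C.ClosedPoint) : C.ord Q 1 = 0 := by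
  have := ord_mul Q 1 1
  rw [mul_one] at this
  lia

theorem ord_inv (Q : C.ClosedPoint) (f : C.RatFuncˣ) : C.ord Q f⁻¹ = -C.ord Q f := by
  have := ord_mul Q f f⁻¹
  rw [mul_inv_cancel, ord_one] at this
  lia

theorem ord_div (Q : C.ClosedPoint) (f g : C.RatFuncˣ) :
    C.ord Q (f / g) = C.ord Q f - C.ord Q g := by
  rw [div_eq_mul_inv, ord_mul, ord_inv, sub_eq_add_neg]

theorem ord_zpow (Q : C.ClosedPoint) (f : C.RatFuncˣ) (n : ℤ) :
    C.ord Q (f ^ n) = n * C.ord Q f := by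
  rw [← div_apply, ofMul_zpow, map_zsmul, Finsupp.smul_apply, div_apply, smul_eq_mul]

theorem ord_pow (Q : C.ClosedPoint) (f : C.RatFuncˣ) (n : ℕ) :
    C.ord Q (f ^ n) = n * C.ord Q f := by
  rw [← zpow_natCast, ord_zpow]

theorem ord_nonneg_iff {f : C.RatFuncˣ} : 0 ≤ C.ord Q f ↔ f.1 ∈ C.valRing Q := by
  rw [← WithZero.exp_le_exp, ← ordFrac_eq_exp_ord, Ring.ordFrac_eq_valuation_inv, WithZero.exp_zero,
    one_le_inv₀ (zero_lt_iff.mpr (by simp))]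
  constructor
  · intro h
    exact IsDiscreteValuationRing.exists_lift_of_le_one h
  · rintro ⟨a, ha⟩
    rw [← ha]
    exact IsDedekindDomain.HeightOneSpectrum.valuation_le_one _ _

theorem ord_eq_zero_iff {f : C.RatFuncˣ} : C.ord Q f = 0 ↔
    ∃ v : (C.X.presheaf.stalk Q.1)ˣ, algebraMap (C.X.presheaf.stalk Q.1) C.RatFunc v = f := by
  constructor
  · intro h
    obtain ⟨a, ha⟩ := ord_nonneg_iff.mp h.ge
    obtain ⟨b, hb⟩ := (ord_nonneg_iff (f := f⁻¹)).mp (by rw [ord_inv, h, neg_zero])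
    have hab : a * b = 1 := by
      apply IsFractionRing.injective (C.X.presheaf.stalk Q.1) C.RatFunc
      rw [map_mul, ha, hb, ← Units.val_mul, mul_inv_cancel, Units.val_one, map_one]
    exact ⟨Units.mkOfMulEqOne a b hab, ha⟩
  · rintro ⟨v, hv⟩
    rw [ord_eq_iff, ← hv, Ring.ordFrac_of_isUnit v.isUnit, WithZero.exp_zero]

theorem ord_min_le_add (Q : C.ClosedPoint) {f g h : C.RatFuncˣ} (hfg : f.1 + g.1 = h.1) :
    min (C.ord Q f) (C.ord Q g) ≤ C.ord Q h := by
  have h0 : f.1 + g.1 ≠ 0 := hfg ▸ h.ne_zero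
  rw [ord, ord, ord, ← hfg]
  exact Scheme.ord_add h0

/-- The functions of positive order are those in the maximal ideal of the local ring. -/
theorem ord_pos_iff {f : C.RatFuncˣ} {a : C.X.presheaf.stalk Q.1}
    (ha : algebraMap _ C.RatFunc a = f) : 0 < C.ord Q f ↔
      a ∈ IsLocalRing.maximalIdeal (C.X.presheaf.stalk Q.1) := by
  have h0 : 0 ≤ C.ord Q f := ord_nonneg_iff.mpr ⟨a, ha⟩
  rw [h0.lt_iff_ne', Ne, ord_eq_zero_iff, IsLocalRing.mem_maximalIdeal, mem_nonunits_iff]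
  refine not_congr ⟨?_, fun h => ⟨h.unit, ha⟩⟩
  rintro ⟨v, hv⟩
  rw [← IsFractionRing.injective (C.X.presheaf.stalk Q.1) C.RatFunc (hv.trans ha.symm)]
  exact v.isUnit

theorem exists_isUniformizer (Q : C.ClosedPoint) : ∃ π : C.RatFuncˣ, C.IsUniformizer Q π := by
  obtain ⟨ϖ, hϖ⟩ := IsDiscreteValuationRing.exists_irreducible (C.X.presheaf.stalk Q.1)
  have h0 : algebraMap _ C.RatFunc ϖ ≠ 0 := by simpa using hϖ.ne_zero
  exact ⟨Units.mk0 _ h0, ord_eq_iff.mpr (Ring.ordFrac_irreducible hϖ)⟩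

theorem valueAt_eq {f : C.RatFuncˣ} (v : (C.X.presheaf.stalk Q.1)ˣ)
    (hv : algebraMap (C.X.presheaf.stalk Q.1) C.RatFunc v = f) :
    C.valueAt Q f =
      Units.map (algebraMap (C.X.presheaf.stalk Q.1) (C.ResidueField Q)).toMonoidHom v := by
  have h : ∃ v : (C.X.presheaf.stalk Q.1)ˣ,
      algebraMap (C.X.presheaf.stalk Q.1) C.RatFunc v = f := ⟨v, hv⟩
  have h2 : h.choose = v := Units.ext
    (IsFractionRing.injective (C.X.presheaf.stalk Q.1) C.RatFunc (h.choose_spec.trans hv.symm))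
  rw [valueAt, dif_pos h, h2]
  rfl

theorem valueAt_mul {f g : C.RatFuncˣ} (hf : C.ord Q f = 0) (hg : C.ord Q g = 0) :
    C.valueAt Q (f * g) = C.valueAt Q f * C.valueAt Q g := by
  obtain ⟨v, hv⟩ := ord_eq_zero_iff.mp hf
  obtain ⟨w, hw⟩ := ord_eq_zero_iff.mp hg
  rw [valueAt_eq v hv, valueAt_eq w hw, valueAt_eq (v * w), map_mul]
  rw [Units.val_mul, map_mul, hv, hw, Units.val_mul]

theorem valueAt_zpow {f : C.RatFuncˣ} (hf : C.ord Q f = 0) (n : ℤ) :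
    C.valueAt Q (f ^ n) = C.valueAt Q f ^ n := by
  obtain ⟨v, hv⟩ := ord_eq_zero_iff.mp hf
  rw [valueAt_eq v hv, valueAt_eq (v ^ n), map_zpow]
  have h : Units.map (algebraMap (C.X.presheaf.stalk Q.1) C.RatFunc).toMonoidHom v = f := Units.ext hv
  rw [← h, ← map_zpow]
  rfl

theorem valueAt_inv {f : C.RatFuncˣ} (hf : C.ord Q f = 0) :
    C.valueAt Q f⁻¹ = (C.valueAt Q f)⁻¹ := by
  simpa using valueAt_zpow hf (-1)

theorem valueAt_pow {f : C.RatFuncˣ} (hf : C.ord Q f = 0) (n : ℕ) :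
    C.valueAt Q (f ^ n) = C.valueAt Q f ^ n := by
  simpa using valueAt_zpow hf n

end SmoothProperCurve

/-! ### Closed points and maximal ideals of Dedekind domains in the function field -/

namespace SmoothProperCurve
open IsDedekindDomain UniqueFactorizationMonoid
variable {k : Type u} [Field k] {C : SmoothProperCurve k}

theorem inv_mem_valRing {Q : C.ClosedPoint} {a : C.X.presheaf.stalk Q.1} (ha : IsUnit a) :
    (algebraMap _ C.RatFunc a)⁻¹ ∈ C.valRing Q := by
  obtain ⟨u, rfl⟩ := ha
  refine ⟨(u⁻¹ : (C.X.presheaf.stalk Q.1)ˣ), eq_inv_of_mul_eq_one_left ?_⟩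
  rw [← map_mul, Units.inv_mul, map_one]

theorem valRing_ne_top (Q : C.ClosedPoint) : C.valRing Q ≠ ⊤ := by
  intro h
  obtain ⟨π, hπ⟩ := exists_isUniformizer Q
  have h2 : 0 ≤ C.ord Q π⁻¹ := ord_nonneg_iff.mpr (h ▸ ValuationSubring.mem_top _)
  rw [ord_inv, hπ] at h2
  lia

/-- The part of a divisor supported on the points where `t` is regular, which are the points of the
affine curve given by the integral closure of `k[t]`. -/
noncomputable def regularPart (t : C.RatFunc) (D : C.Div) : C.Div :=
  open Classical in D.filter fun Q => t ∈ C.valRing Q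

theorem regularPart_apply_of_mem {t : C.RatFunc} {Q : C.ClosedPoint} (h : t ∈ C.valRing Q)
    (D : C.Div) : regularPart t D Q = D Q := by
  classical
  exact Finsupp.filter_apply_pos (fun Q => t ∈ C.valRing Q) D h

theorem regularPart_apply_of_notMem {t : C.RatFunc} {Q : C.ClosedPoint} (h : t ∉ C.valRing Q)
    (D : C.Div) : regularPart t D Q = 0 := by
  classical
  exact Finsupp.filter_apply_neg (fun Q => t ∈ C.valRing Q) D h

theorem regularPart_add (t : C.RatFunc) (D E : C.Div) :
    regularPart t (D + E) = regularPart t D + regularPart t E := by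
  classical
  exact Finsupp.filter_add

section toStalk

variable {B : Type*} [CommRing B] [Algebra k B] [Algebra B C.RatFunc] [IsScalarTower k B C.RatFunc]

/-- The inclusion in the local ring at `Q` of an algebra of functions that are regular at `Q`. -/
noncomputable def toStalk {Q : C.ClosedPoint}
    (hQ : ∀ b : B, algebraMap B C.RatFunc b ∈ C.valRing Q) : B →ₐ[k] C.X.presheaf.stalk Q.1 :=
  (AlgEquiv.ofInjective (IsScalarTower.toAlgHom k (C.X.presheaf.stalk Q.1) C.RatFunc)
      (IsFractionRing.injective _ _)).symm.toAlgHom.comp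
    ((IsScalarTower.toAlgHom k B C.RatFunc).codRestrict _ hQ)

theorem algebraMap_toStalk {Q : C.ClosedPoint}
    (hQ : ∀ b : B, algebraMap B C.RatFunc b ∈ C.valRing Q) (b : B) :
    algebraMap (C.X.presheaf.stalk Q.1) C.RatFunc (toStalk hQ b) = algebraMap B C.RatFunc b := by
  have h := AlgEquiv.apply_symm_apply
    (AlgEquiv.ofInjective (IsScalarTower.toAlgHom k (C.X.presheaf.stalk Q.1) C.RatFunc)
      (IsFractionRing.injective _ _))
      ((IsScalarTower.toAlgHom k B C.RatFunc).codRestrict _ hQ b)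
  exact congr_arg Subtype.val h

end toStalk

variable {B : Type*} [CommRing B] [IsDedekindDomain B] [Algebra k B] [Algebra B C.RatFunc]
  [IsFractionRing B C.RatFunc] [IsScalarTower k B C.RatFunc]

theorem exists_valRing_eq_valuationSubring (v : HeightOneSpectrum B) :
    ∃ Q, C.valRing Q = (v.valuation C.RatFunc).valuationSubring := by
  refine C.exists_valRing_eq _ (fun c => ?_) ?_
  · rw [IsScalarTower.algebraMap_apply k B C.RatFunc]
    exact v.valuation_le_one _
  · simp only [ne_eq, Valuation.valuationSubring_eq_top_iff, not_not]
    infer_instance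

/-- The closed point of the curve given by a maximal ideal of a Dedekind domain `B` whose fraction
field is the function field: the one whose local ring is the localization of `B`. -/
noncomputable def ofPrime (v : HeightOneSpectrum B) : C.ClosedPoint :=
  (exists_valRing_eq_valuationSubring (C := C) v).choose

theorem mem_valRing_ofPrime {v : HeightOneSpectrum B} {f : C.RatFunc} :
    f ∈ C.valRing (ofPrime v) ↔ v.valuation C.RatFunc f ≤ 1 := by
  rw [ofPrime, (exists_valRing_eq_valuationSubring (C := C) v).choose_spec]
  rfl

theorem algebraMap_mem_valRing_ofPrime (v : HeightOneSpectrum B) (b : B) :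
    algebraMap B C.RatFunc b ∈ C.valRing (ofPrime v) :=
  mem_valRing_ofPrime.mpr (v.valuation_le_one b)

/-- Both sides are valuations with the same valuation ring, and both take the value of a
uniformizer. -/
theorem valuation_eq_exp_neg_ord (v : HeightOneSpectrum B) (f : C.RatFuncˣ) :
    v.valuation C.RatFunc f.1 = WithZero.exp (-C.ord (ofPrime v) f) := by
  have hnn (f : C.RatFuncˣ) : 0 ≤ C.ord (ofPrime v) f ↔ v.valuation C.RatFunc f.1 ≤ 1 :=
    ord_nonneg_iff.trans mem_valRing_ofPrime
  have h0 (f : C.RatFuncˣ) (hf : v.valuation C.RatFunc f.1 = 1) : C.ord (ofPrime v) f = 0 := by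
    refine le_antisymm ?_ ((hnn f).mpr hf.le)
    have := (hnn f⁻¹).mpr (by simp [hf])
    rw [ord_inv] at this
    lia
  obtain ⟨p, hp⟩ := v.valuation_exists_uniformizer C.RatFunc
  have hp0 : p ≠ 0 := by
    rintro rfl
    rw [map_zero] at hp
    exact WithZero.exp_ne_zero hp.symm
  lift p to C.RatFuncˣ using hp0.isUnit
  have hlog (f : C.RatFuncˣ) : ∃ m : ℤ, v.valuation C.RatFunc f.1 = WithZero.exp (-m) ∧
      C.ord (ofPrime v) f = m * C.ord (ofPrime v) p := by
    have hf0 : v.valuation C.RatFunc f.1 ≠ 0 := by simp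
    refine ⟨-WithZero.log (v.valuation C.RatFunc f.1), by rw [neg_neg, WithZero.exp_log hf0], ?_⟩
    have := h0 (f * p ^ (WithZero.log (v.valuation C.RatFunc f.1))) (by
      rw [Units.val_mul, map_mul, Units.val_zpow_eq_zpow_val, map_zpow₀, hp, ← WithZero.exp_zsmul]
      conv_lhs => rw [← WithZero.exp_log hf0]
      rw [← WithZero.exp_add, WithZero.log_exp]
      simp)
    rw [ord_mul, ord_zpow] at this
    rw [neg_mul]
    exact eq_neg_of_add_eq_zero_left this
  -- The orders of all functions are multiples of the order of `p`, and some function has order one.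
  obtain ⟨π, hπ⟩ := exists_isUniformizer (C := C) (ofPrime v)
  obtain ⟨m, -, hm⟩ := hlog π
  rw [hπ] at hm
  have hp1 : C.ord (ofPrime v) p = 1 := by
    have h1 : 0 ≤ C.ord (ofPrime v) p := (hnn p).mpr (by
      rw [hp, ← WithZero.exp_zero, WithZero.exp_le_exp]; simp)
    exact Int.eq_one_or_neg_one_of_mul_eq_one' hm.symm |>.elim (·.2) fun h => by lia
  obtain ⟨m, h1, h2⟩ := hlog f
  rw [h1, h2, hp1, mul_one]

theorem ofPrime_injective : Function.Injective (ofPrime (C := C) (B := B)) := by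
  intro v w h
  refine HeightOneSpectrum.eq_of_valuation_isEquiv_valuation (K := C.RatFunc) ?_
  refine Valuation.isEquiv_iff_val_le_one.mpr fun {x} => ?_
  rw [← mem_valRing_ofPrime, h, mem_valRing_ofPrime]

/-- Every closed point where all elements of `B` are regular comes from a maximal ideal of `B`. -/
theorem exists_ofPrime_eq {Q : C.ClosedPoint}
    (hQ : ∀ b : B, algebraMap B C.RatFunc b ∈ C.valRing Q) :
    ∃ v : HeightOneSpectrum B, ofPrime v = Q := by
  have hp (b : B)
      (hb : b ∉ (IsLocalRing.maximalIdeal (C.X.presheaf.stalk Q.1)).comap (toStalk hQ)) :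
      (algebraMap B C.RatFunc b)⁻¹ ∈ C.valRing Q := by
    rw [← algebraMap_toStalk hQ]
    exact inv_mem_valRing (IsLocalRing.notMem_maximalIdeal.mp hb)
  have hp0 : (IsLocalRing.maximalIdeal (C.X.presheaf.stalk Q.1)).comap (toStalk hQ) ≠ ⊥ := by
    refine fun h => valRing_ne_top Q (top_le_iff.mp fun f _ => ?_)
    obtain ⟨a, b, hb, rfl⟩ := IsFractionRing.div_surjective (A := B) f
    rw [div_eq_mul_inv]
    refine mul_mem (hQ a) (hp b fun hbp => ?_)
    rw [h] at hbp
    exact nonZeroDivisors.ne_zero hb hbp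
  let v : HeightOneSpectrum B := ⟨_, Ideal.comap_isPrime _ _, hp0⟩
  refine ⟨v, C.valRing_injective ?_⟩
  refine (C.eq_valRing_of_valRing_le (Q := ofPrime v) (fun f hf => ?_) (valRing_ne_top Q)).symm
  obtain ⟨a, s, has⟩ := v.exists_primeCompl_mul_eq_of_integer (K := C.RatFunc) f
    (mem_valRing_ofPrime.mp hf)
  have hs0 : algebraMap B C.RatFunc s ≠ 0 := by
    simpa using fun h : (s : B) = 0 => s.2 (h ▸ v.asIdeal.zero_mem)
  rw [(eq_div_iff hs0).mpr has, div_eq_mul_inv]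
  exact mul_mem (hQ a) (hp s s.2)

/-- Reduction of the elements of `B` at a closed point. -/
noncomputable def reduction (v : HeightOneSpectrum B) : B →ₐ[k] C.ResidueField (ofPrime v) :=
  (IsScalarTower.toAlgHom k (C.X.presheaf.stalk (ofPrime v).1) (C.ResidueField (ofPrime v))).comp
    (toStalk (algebraMap_mem_valRing_ofPrime v))

theorem algebraMap_residueField_eq_zero_iff {Q : C.ClosedPoint} {a : C.X.presheaf.stalk Q.1} :
    algebraMap _ (C.ResidueField Q) a = 0 ↔
      a ∈ IsLocalRing.maximalIdeal (C.X.presheaf.stalk Q.1) :=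
  IsLocalRing.residue_eq_zero_iff a

theorem toStalk_mem_maximalIdeal_iff (v : HeightOneSpectrum B) (b : B) :
    toStalk (C := C) (algebraMap_mem_valRing_ofPrime v) b ∈ IsLocalRing.maximalIdeal _ ↔
      b ∈ v.asIdeal := by
  obtain rfl | hb := eq_or_ne b 0
  · simp
  let f : C.RatFuncˣ := Units.mk0 (algebraMap B C.RatFunc b) (by simpa using hb)
  rw [← ord_pos_iff (f := f) (algebraMap_toStalk _ b), ← v.valuation_lt_one_iff_mem (K := C.RatFunc) b]
  change _ ↔ v.valuation C.RatFunc f.1 < 1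
  rw [valuation_eq_exp_neg_ord, ← WithZero.exp_zero,
    WithZero.exp_lt_exp, neg_lt_zero]

theorem reduction_eq_zero_iff (v : HeightOneSpectrum B) (b : B) :
    reduction (C := C) v b = 0 ↔ b ∈ v.asIdeal :=
  algebraMap_residueField_eq_zero_iff.trans (toStalk_mem_maximalIdeal_iff v b)

theorem reduction_surjective (v : HeightOneSpectrum B) :
    Function.Surjective (reduction (C := C) v) := by
  intro y
  obtain ⟨x, rfl⟩ : ∃ x, algebraMap (C.X.presheaf.stalk (ofPrime v).1) _ x = y :=
    IsLocalRing.residue_surjective y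
  obtain ⟨a, s, has⟩ := v.exists_primeCompl_mul_eq_of_integer (K := C.RatFunc) (algebraMap _ _ x)
    (mem_valRing_ofPrime.mp ⟨x, rfl⟩)
  obtain ⟨s', hs'⟩ := Ideal.Quotient.exists_inv (I := v.asIdeal) (a := Ideal.Quotient.mk _ s.1)
    (mt Ideal.Quotient.eq_zero_iff_mem.mp s.2)
  obtain ⟨s', rfl⟩ := Ideal.Quotient.mk_surjective s'
  rw [← map_mul, ← map_one (Ideal.Quotient.mk v.asIdeal), Ideal.Quotient.eq,
    ← reduction_eq_zero_iff (C := C), map_sub, map_one, sub_eq_zero, map_mul] at hs'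
  have h1 : x * toStalk (algebraMap_mem_valRing_ofPrime v) s.1 =
      toStalk (algebraMap_mem_valRing_ofPrime v) a := by
    apply IsFractionRing.injective (C.X.presheaf.stalk (ofPrime v).1) C.RatFunc
    rw [map_mul, algebraMap_toStalk, algebraMap_toStalk, has]
  have h2 : algebraMap _ (C.ResidueField (ofPrime v)) x * reduction v s.1 = reduction v a :=
    (map_mul (algebraMap (C.X.presheaf.stalk (ofPrime v).1) (C.ResidueField (ofPrime v)))
      _ _).symm.trans (congr_arg _ h1)
  refine ⟨a * s', ?_⟩
  rw [map_mul, ← h2, mul_assoc, hs', mul_one]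

/-- The residue fields of `B` are those of the curve. -/
noncomputable def residueEquiv (v : HeightOneSpectrum B) :
    (B ⧸ v.asIdeal) ≃ₐ[k] C.ResidueField (ofPrime v) :=
  AlgEquiv.ofBijective (Ideal.Quotient.liftₐ v.asIdeal (reduction v)
      fun b hb => (reduction_eq_zero_iff v b).mpr hb) <| by
    constructor
    · refine (injective_iff_map_eq_zero _).mpr fun x hx => ?_
      obtain ⟨b, rfl⟩ := Ideal.Quotient.mk_surjective x
      exact Ideal.Quotient.eq_zero_iff_mem.mpr ((reduction_eq_zero_iff v b).mp hx)
    · intro y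
      obtain ⟨b, rfl⟩ := reduction_surjective v y
      exact ⟨Ideal.Quotient.mk _ b, rfl⟩

theorem norm_valueAt_ofPrime (v : HeightOneSpectrum B) {b : B} {f : C.RatFuncˣ}
    (hf : algebraMap B C.RatFunc b = f) (h0 : C.ord (ofPrime v) f = 0) :
    Algebra.norm k (C.valueAt (ofPrime v) f).1 =
      Algebra.norm k (Ideal.Quotient.mk v.asIdeal b) := by
  obtain ⟨w, hw⟩ := ord_eq_zero_iff.mp h0
  have h1 : w.1 = toStalk (algebraMap_mem_valRing_ofPrime v) b := by
    apply IsFractionRing.injective (C.X.presheaf.stalk (ofPrime v).1) C.RatFunc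
    rw [hw, algebraMap_toStalk, hf]
  have h2 : (C.valueAt (ofPrime v) f).1 = residueEquiv v (Ideal.Quotient.mk v.asIdeal b) := by
    rw [valueAt_eq w hw]
    exact congr_arg (algebraMap _ (C.ResidueField (ofPrime v))) h1
  rw [h2]
  exact Algebra.norm_eq_of_algEquiv (residueEquiv v) _

theorem count_normalizedFactors_span (v : HeightOneSpectrum B) {b : B} {f : C.RatFuncˣ}
    (hf : algebraMap B C.RatFunc b = f) [DecidableEq (Ideal B)] :
    ((normalizedFactors (Ideal.span {b})).count v.asIdeal : ℤ) = C.ord (ofPrime v) f := by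
  have hb : b ≠ 0 := by
    rintro rfl
    exact f.ne_zero (by rw [← hf, map_zero])
  have h := valuation_eq_exp_neg_ord v f
  rw [← hf, v.valuation_of_algebraMap, v.intValuation_eq_exp_neg_multiplicity hb,
    WithZero.exp_inj, neg_inj] at h
  rw [← h, multiplicity_eq_count_normalizedFactors v.irreducible (by simpa using hb), normalize_eq]

/-- If the elements of `B` are regular at the same points as `t`, a product over the prime factors
of a principal ideal of `B` is a product over the divisor of the generator. -/
theorem prod_map_normalizedFactors_span {M : Type*} [CommMonoid M] {t : C.RatFunc}
    (ht : ∀ Q, t ∈ C.valRing Q ↔ ∀ b : B, algebraMap B C.RatFunc b ∈ C.valRing Q)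
    {b : B} {f : C.RatFuncˣ} (hf : algebraMap B C.RatFunc b = f)
    (φ : Ideal B → M) (ψ : C.ClosedPoint → M)
    (h : ∀ v : HeightOneSpectrum B, C.ord (ofPrime v) f ≠ 0 → φ v.asIdeal = ψ (ofPrime v)) :
    ((normalizedFactors (Ideal.span {b})).map φ).prod =
      (regularPart t (C.div (Additive.ofMul f))).prod fun Q e => ψ Q ^ e.toNat := by
  classical
  rw [Finset.prod_multiset_map_count, Finsupp.prod]
  have hpr (p : Ideal B) (hp : p ∈ (normalizedFactors (Ideal.span {b})).toFinset) : Prime p :=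
    prime_of_normalized_factor p (Multiset.mem_toFinset.mp hp)
  let V (p : Ideal B) (hp : p ∈ (normalizedFactors (Ideal.span {b})).toFinset) :
      HeightOneSpectrum B := ⟨p, Ideal.isPrime_of_prime (hpr p hp), (hpr p hp).ne_zero⟩
  have hreg (v : HeightOneSpectrum B) : t ∈ C.valRing (ofPrime v) :=
    (ht _).mpr (algebraMap_mem_valRing_ofPrime v)
  have hcount (p : Ideal B) (hp : p ∈ (normalizedFactors (Ideal.span {b})).toFinset) :
      C.ord (ofPrime (V p hp)) f ≠ 0 := by
    rw [← count_normalizedFactors_span (V p hp) hf]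
    exact_mod_cast (Multiset.count_pos.mpr (Multiset.mem_toFinset.mp hp)).ne'
  refine Finset.prod_bij (fun p hp => ofPrime (V p hp)) (fun p hp => ?_) (fun p hp q hq hpq => ?_)
    (fun Q hQ => ?_) (fun p hp => ?_)
  · rw [Finsupp.mem_support_iff, regularPart_apply_of_mem (hreg _)]
    exact hcount p hp
  · exact congr_arg HeightOneSpectrum.asIdeal (ofPrime_injective hpq)
  · rw [regularPart, Finsupp.support_filter, Finset.mem_filter, Finsupp.mem_support_iff] at hQ
    obtain ⟨hQ, hQt⟩ := hQ
    obtain ⟨v, rfl⟩ := exists_ofPrime_eq ((ht Q).mp hQt)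
    refine ⟨v.asIdeal, ?_, rfl⟩
    rw [div_apply, ← count_normalizedFactors_span v hf] at hQ
    exact Multiset.mem_toFinset.mpr (Multiset.count_ne_zero.mp (by exact_mod_cast hQ))
  · rw [h (V p hp) (hcount p hp), regularPart_apply_of_mem (hreg _), div_apply,
      ← count_normalizedFactors_span (V p hp) hf, Int.toNat_natCast]

end SmoothProperCurve

/-! ### Reciprocity for separating functions -/

namespace SmoothProperCurve
open IsDedekindDomain UniqueFactorizationMonoid
variable {k : Type u} [Field k] {C : SmoothProperCurve k}

/-- The value `∏ N(f(Q_j)) ^ e_j` of a rational function `f` on a divisor `∑ e_j Q_j`. It is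
meaningful if `f` has order zero on the support of the divisor. -/
noncomputable def evalDiv (f : C.RatFuncˣ) (E : C.Div) : kˣ :=
  E.prod fun Q e => Units.map (Algebra.norm k : C.ResidueField Q →* k) (C.valueAt Q f) ^ e

theorem evalDiv_add (f : C.RatFuncˣ) (D E : C.Div) :
    evalDiv f (D + E) = evalDiv f D * evalDiv f E := by
  classical
  exact Finsupp.prod_add_index' (fun _ => zpow_zero _) fun _ _ _ => zpow_add _ _ _

theorem evalDiv_zero (f : C.RatFuncˣ) : evalDiv f (0 : C.Div) = 1 := Finsupp.prod_zero_index

theorem evalDiv_neg (f : C.RatFuncˣ) (D : C.Div) : evalDiv f (-D) = (evalDiv f D)⁻¹ := by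
  rw [eq_inv_iff_mul_eq_one, ← evalDiv_add, neg_add_cancel, evalDiv_zero]

theorem evalDiv_sub (f : C.RatFuncˣ) (D E : C.Div) :
    evalDiv f (D - E) = evalDiv f D / evalDiv f E := by
  rw [sub_eq_add_neg, evalDiv_add, evalDiv_neg, div_eq_mul_inv]

theorem evalDiv_nsmul (f : C.RatFuncˣ) (n : ℕ) (D : C.Div) :
    evalDiv f (n • D) = evalDiv f D ^ n := by
  induction n with
  | zero => rw [zero_smul, pow_zero, evalDiv_zero]
  | succ n ih => rw [succ_nsmul, evalDiv_add, ih, pow_succ]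

theorem evalDiv_mul {f g : C.RatFuncˣ} {E : C.Div} (hf : ∀ Q, E Q ≠ 0 → C.ord Q f = 0)
    (hg : ∀ Q, E Q ≠ 0 → C.ord Q g = 0) : evalDiv (f * g) E = evalDiv f E * evalDiv g E := by
  rw [evalDiv, evalDiv, evalDiv, ← Finsupp.prod_mul]
  refine Finsupp.prod_congr fun Q hQ => ?_
  rw [Finsupp.mem_support_iff] at hQ
  rw [valueAt_mul (hf Q hQ) (hg Q hQ), map_mul, mul_zpow]

theorem evalDiv_inv {f : C.RatFuncˣ} {E : C.Div} (hf : ∀ Q, E Q ≠ 0 → C.ord Q f = 0) :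
    evalDiv f⁻¹ E = (evalDiv f E)⁻¹ := by
  rw [evalDiv, evalDiv, ← Finsupp.prod_inv]
  refine Finsupp.prod_congr fun Q hQ => ?_
  rw [Finsupp.mem_support_iff] at hQ
  rw [valueAt_inv (hf Q hQ), map_inv, inv_zpow]

theorem evalDiv_pow {f : C.RatFuncˣ} {E : C.Div} (hf : ∀ Q, E Q ≠ 0 → C.ord Q f = 0) (n : ℕ) :
    evalDiv (f ^ n) E = evalDiv f E ^ n := by
  rw [evalDiv, evalDiv, Finsupp.prod, Finsupp.prod, ← Finset.prod_pow]
  refine Finset.prod_congr rfl fun Q hQ => ?_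
  rw [Finsupp.mem_support_iff] at hQ
  rw [valueAt_pow (hf Q hQ), map_pow, ← zpow_natCast, ← zpow_natCast, zpow_comm]

theorem deg_apply (D : C.Div) :
    C.deg D = D.sum fun Q e => e * (Module.finrank k (C.ResidueField Q) : ℤ) := rfl

theorem coe_evalDiv (f : C.RatFuncˣ) {E : C.Div} (hE : ∀ Q, 0 ≤ E Q) :
    (evalDiv f E : k) = E.prod fun Q e => Algebra.norm k (C.valueAt Q f).1 ^ e.toNat := by
  rw [evalDiv, Finsupp.prod, Units.coe_prod]
  refine Finset.prod_congr rfl fun Q _ => ?_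
  obtain ⟨n, hn⟩ := Int.eq_ofNat_of_zero_le (hE Q)
  simp only [hn, Int.toNat_natCast]
  rw [zpow_natCast, Units.val_pow_eq_pow_val]
  rfl

theorem regularPart_div_nonneg {B : Type*} [CommRing B] [Algebra B C.RatFunc] {t : C.RatFunc}
    (ht : ∀ Q, t ∈ C.valRing Q → ∀ b : B, algebraMap B C.RatFunc b ∈ C.valRing Q)
    {b : B} {f : C.RatFuncˣ} (hf : algebraMap B C.RatFunc b = f) (Q : C.ClosedPoint) :
    0 ≤ regularPart t (C.div (Additive.ofMul f)) Q := by
  by_cases hQ : t ∈ C.valRing Q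
  · rw [regularPart_apply_of_mem hQ, div_apply, ord_nonneg_iff, ← hf]
    exact ht Q hQ b
  · rw [regularPart_apply_of_notMem hQ]

section Dedekind

variable {B : Type*} [CommRing B] [IsDedekindDomain B] [Algebra k B] [Algebra B C.RatFunc]
  [IsFractionRing B C.RatFunc] [IsScalarTower k B C.RatFunc]

theorem ord_ofPrime_pos_iff {v : HeightOneSpectrum B} {b : B} {f : C.RatFuncˣ}
    (hf : algebraMap B C.RatFunc b = f) : 0 < C.ord (ofPrime v) f ↔ b ∈ v.asIdeal := by
  rw [ord_pos_iff ((algebraMap_toStalk (algebraMap_mem_valRing_ofPrime v) b).trans hf),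
    toStalk_mem_maximalIdeal_iff]

/-- The value of `g` on the zeros of `f` in the affine curve given by `B` is the norm of `g` on
`B / f`. -/
theorem coe_evalDiv_regularPart_div {t : C.RatFunc}
    (ht : ∀ Q, t ∈ C.valRing Q ↔ ∀ b : B, algebraMap B C.RatFunc b ∈ C.valRing Q)
    {b c : B} {f g : C.RatFuncˣ} (hf : algebraMap B C.RatFunc b = f)
    (hg : algebraMap B C.RatFunc c = g)
    (h : ∀ Q, t ∈ C.valRing Q → C.ord Q f ≠ 0 → C.ord Q g = 0)
    [Module.Finite k (B ⧸ Ideal.span {b})] :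
    (evalDiv g (regularPart t (C.div (Additive.ofMul f))) : k) =
      Algebra.norm k (Ideal.Quotient.mk (Ideal.span {b}) c) := by
  have hb : b ≠ 0 := by
    rintro rfl
    exact f.ne_zero (by rw [← hf, map_zero])
  rw [Ideal.norm_quotient_eq_prod _ _ (by simpa using hb), coe_evalDiv _
    (regularPart_div_nonneg (fun Q => (ht Q).mp) hf)]
  refine (prod_map_normalizedFactors_span ht hf _ _ fun v hv => ?_).symm
  exact (norm_valueAt_ofPrime v hg
    (h _ ((ht _).mpr (algebraMap_mem_valRing_ofPrime v)) hv)).symm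

theorem deg_regularPart_div {t : C.RatFunc}
    (ht : ∀ Q, t ∈ C.valRing Q ↔ ∀ b : B, algebraMap B C.RatFunc b ∈ C.valRing Q)
    {b : B} {f : C.RatFuncˣ} (hf : algebraMap B C.RatFunc b = f)
    [Module.Finite k (B ⧸ Ideal.span {b})] :
    C.deg (regularPart t (C.div (Additive.ofMul f))) =
      Module.finrank k (B ⧸ Ideal.span {b}) := by
  have hb : b ≠ 0 := by
    rintro rfl
    exact f.ne_zero (by rw [← hf, map_zero])
  have h := prod_map_normalizedFactors_span ht hf
    (fun p => Multiplicative.ofAdd (Module.finrank k (B ⧸ p)))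
    (fun Q => Multiplicative.ofAdd (Module.finrank k (C.ResidueField Q)))
    fun v _ => congr_arg _ (residueEquiv v).toLinearEquiv.finrank_eq
  have h2 := congr_arg Multiplicative.toAdd h
  rw [toAdd_multiset_sum, Multiset.map_map] at h2
  rw [Ideal.finrank_quotient_eq_sum_normalizedFactors _ (by simpa using hb)]
  refine Eq.trans ?_ (congr_arg ((↑) : ℕ → ℤ) h2.symm)
  rw [deg_apply, Finsupp.prod, toAdd_prod, Finsupp.sum, Nat.cast_sum]
  refine Finset.sum_congr rfl fun Q _ => ?_
  rw [← ofAdd_nsmul, toAdd_ofAdd, smul_eq_mul, Nat.cast_mul,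
    Int.toNat_of_nonneg (regularPart_div_nonneg (fun Q => (ht Q).mp) hf Q)]

end Dedekind

theorem finite_quotient_span {B : Type*} [CommRing B] [IsDedekindDomain B] [Algebra k B]
    [Algebra k[X] B] [IsScalarTower k k[X] B] [Module.Finite k[X] B] {b : B} (hb : b ≠ 0) :
    Module.Finite k (B ⧸ Ideal.span {b}) := by
  have : Algebra.FiniteType k B := .trans (S := k[X]) inferInstance inferInstance
  have : Algebra.FiniteType k (B ⧸ Ideal.span {b}) := .of_surjective
    (Ideal.Quotient.mkₐ k _) Ideal.Quotient.mk_surjective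
  have : IsFiniteLength B (B ⧸ Ideal.span {b}) :=
    isFiniteLength_quotient_span_singleton B (mem_nonZeroDivisors_of_ne_zero hb)
  rw [isFiniteLength_iff_isNoetherian_isArtinian] at this
  have := this.2
  have : IsArtinianRing (B ⧸ Ideal.span {b}) := isArtinian_of_tower B this
  exact Module.finite_of_isArtinianRing k _


section PolynomialModel

variable {B : Type*} [CommRing B] [IsDedekindDomain B] [Algebra k B] [Algebra B C.RatFunc]
  [IsFractionRing B C.RatFunc] [IsScalarTower k B C.RatFunc] [Algebra k[X] B]
  [IsScalarTower k k[X] B] [Module.Finite k[X] B]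

theorem algebraMap_algebraMap_eq_aeval {B : Type*} [CommRing B] [Algebra k B] [Algebra B C.RatFunc]
    [IsScalarTower k B C.RatFunc] [Algebra k[X] B] [IsScalarTower k k[X] B] {t : C.RatFunc}
    (hX : algebraMap B C.RatFunc (algebraMap k[X] B Polynomial.X) = t) (p : k[X]) :
    algebraMap B C.RatFunc (algebraMap k[X] B p) = aeval t p := by
  let φ : k[X] →ₐ[k] C.RatFunc := (IsScalarTower.toAlgHom k B C.RatFunc).comp
    (IsScalarTower.toAlgHom k k[X] B)
  have : φ = aeval t := Polynomial.algHom_ext (by rw [aeval_X]; exact hX)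
  rw [← this]
  rfl

/-- The points where `t` is regular are those where all functions integral over `k[t]` are. -/
theorem mem_valRing_iff_of_finite {B : Type*} [CommRing B] [Algebra k B] [Algebra B C.RatFunc]
    [IsScalarTower k B C.RatFunc] [Algebra k[X] B] [IsScalarTower k k[X] B] [Module.Finite k[X] B]
    {t : C.RatFunc} (hX : algebraMap B C.RatFunc (algebraMap k[X] B Polynomial.X) = t) (Q : C.ClosedPoint) :
    t ∈ C.valRing Q ↔ ∀ b : B, algebraMap B C.RatFunc b ∈ C.valRing Q := by
  refine ⟨?_, fun h => hX ▸ h _⟩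
  rintro ⟨a, rfl⟩ b
  have hb : IsIntegral k[X] b := Algebra.IsIntegral.isIntegral b
  obtain ⟨p, hp, hpb⟩ := hb
  have : IsIntegral (C.X.presheaf.stalk Q.1) (algebraMap B C.RatFunc b) := by
    refine ⟨p.map (aeval (R := k) a).toRingHom, hp.map _, ?_⟩
    rw [eval₂_map, ← RingHom.map_zero (algebraMap B C.RatFunc), ← hpb, hom_eval₂]
    congr 1
    refine RingHom.ext fun q => ?_
    exact (aeval_algebraMap_apply _ a q).symm.trans (algebraMap_algebraMap_eq_aeval hX q).symm
  exact IsIntegrallyClosed.isIntegral_iff.mp this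

/-- A polynomial in `t` with non-zero constant term has order zero at the zeros of `t`. -/
theorem ord_aeval_eq_zero {t u : C.RatFuncˣ}
    (hX : algebraMap B C.RatFunc (algebraMap k[X] B Polynomial.X) = t) {q : k[X]}
    (hu : aeval t.1 q = u) (hq : q.eval 0 ≠ 0) {Q : C.ClosedPoint} (hQ : 0 < C.ord Q t) :
    C.ord Q u = 0 := by
  have htQ : t.1 ∈ C.valRing Q := ord_nonneg_iff.mp hQ.le
  obtain ⟨v, rfl⟩ := exists_ofPrime_eq ((mem_valRing_iff_of_finite hX Q).mp htQ)
  rw [← algebraMap_algebraMap_eq_aeval hX] at hu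
  refine le_antisymm (not_lt.mp fun h => ?_)
    (ord_nonneg_iff.mpr (hu ▸ algebraMap_mem_valRing_ofPrime v _))
  rw [ord_ofPrime_pos_iff hu] at h
  rw [ord_ofPrime_pos_iff hX] at hQ
  have h1 : algebraMap k B (q.eval 0) ∈ v.asIdeal := by
    have h2 : algebraMap k[X] B q = algebraMap k[X] B Polynomial.X * algebraMap k[X] B q.divX +
        algebraMap k B (q.eval 0) := by
      conv_lhs => rw [← X_mul_divX_add q, coeff_zero_eq_eval_zero]
      rw [map_add, map_mul, ← algebraMap_eq, ← IsScalarTower.algebraMap_apply]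
    exact (Ideal.add_mem_iff_right _ (Ideal.mul_mem_right _ _ hQ)).mp (h2 ▸ h)
  exact v.isPrime.ne_top (Ideal.eq_top_of_isUnit_mem _ h1 ((Ne.isUnit hq).map _))

variable [Module.Free k[X] B]

/-- Every function is a fraction whose numerator is integral over `k[t]` and whose denominator is a
polynomial in `t`; the latter does not vanish at the zeros of `t` if the function has neither
zeros nor poles there. -/
theorem exists_algebraMap_eq_mul_aeval {t : C.RatFuncˣ}
    (hX : algebraMap B C.RatFunc (algebraMap k[X] B Polynomial.X) = t) {f : C.RatFuncˣ}
    (hf : ∀ Q, 0 < C.ord Q t → C.ord Q f = 0) :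
    ∃ (b : B) (q : k[X]), q.eval 0 ≠ 0 ∧ algebraMap B C.RatFunc b = f * aeval t.1 q := by
  obtain ⟨a, s, hs, hfs⟩ := IsFractionRing.div_surjective (A := B) f.1
  have hs0 : s ≠ 0 := nonZeroDivisors.ne_zero hs
  have hcomap := Ideal.comap_ne_bot_of_integral_mem (R := k[X]) hs0
    (Ideal.mem_span_singleton_self s) (Algebra.IsIntegral.isIntegral s)
  obtain ⟨q, hq, hq0⟩ := Submodule.exists_mem_ne_zero_of_ne_bot hcomap
  obtain ⟨c, hc⟩ := Ideal.mem_span_singleton'.mp hq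
  -- The factor of `q` that is a power of `t` is not needed to clear denominators, as `f` has order
  -- zero at the zeros of `t`.
  obtain ⟨q', hqq', hq'⟩ := Polynomial.exists_eq_pow_rootMultiplicity_mul_and_not_dvd q hq0 0
  rw [C_0, sub_zero] at hqq' hq'
  have hq'0 : q'.eval 0 ≠ 0 := by
    rwa [← coeff_zero_eq_eval_zero, Ne, ← X_dvd_iff]
  have hinj : Function.Injective (algebraMap k[X] B) := FaithfulSMul.algebraMap_injective _ _
  have hu0 : aeval t.1 q' ≠ 0 := by
    rw [← algebraMap_algebraMap_eq_aeval hX, Ne,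
      map_eq_zero_iff _ (IsFractionRing.injective B C.RatFunc), map_eq_zero_iff _ hinj]
    rintro rfl
    exact hq'0 eval_zero
  have hca : algebraMap B C.RatFunc (c * a) =
      f * (aeval t.1 q' * t ^ (rootMultiplicity 0 q)) := by
    have h1 : algebraMap B C.RatFunc (algebraMap k[X] B q) =
        aeval t.1 q' * t ^ (rootMultiplicity 0 q) := by
      rw [algebraMap_algebraMap_eq_aeval hX]
      conv_lhs => rw [hqq']
      rw [map_mul, map_pow, aeval_X, mul_comm]
    have hs0' : algebraMap B C.RatFunc s ≠ 0 := by simpa using hs0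
    rw [← h1, ← hc, ← hfs, map_mul, map_mul]
    field_simp
  suffices h : f.1 * aeval t.1 q' ∈ (algebraMap B C.RatFunc).range by
    obtain ⟨b, hb⟩ := h
    exact ⟨b, q', hq'0, hb⟩
  let u : C.RatFuncˣ := Units.mk0 _ hu0
  refine HeightOneSpectrum.mem_integers_of_valuation_le_one _ _ fun v => ?_
  change v.valuation C.RatFunc (f * u : C.RatFuncˣ).1 ≤ 1
  rw [← mem_valRing_ofPrime, ← ord_nonneg_iff, ord_mul]
  have hu : 0 ≤ C.ord (ofPrime v) u := by
    rw [ord_nonneg_iff]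
    change aeval t.1 q' ∈ C.valRing (ofPrime v)
    rw [← algebraMap_algebraMap_eq_aeval hX q']
    exact algebraMap_mem_valRing_ofPrime v _
  have ht : 0 ≤ C.ord (ofPrime v) t := by
    rw [ord_nonneg_iff]
    exact hX ▸ algebraMap_mem_valRing_ofPrime v _
  obtain ht | ht := ht.lt_or_eq
  · rw [hf _ ht, zero_add]
    exact hu
  · have h1 : 0 ≤ C.ord (ofPrime v) (f * (u * t ^ (rootMultiplicity 0 q))) := by
      rw [ord_nonneg_iff]
      refine Eq.subst (motive := (· ∈ C.valRing (ofPrime v))) ?_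
        (algebraMap_mem_valRing_ofPrime v (c * a))
      rw [hca]
      rfl
    rw [ord_mul, ord_mul, ord_pow, ← ht] at h1
    simpa using h1

/-- Here `P₁` is the norm of a multiple `f * q(t) ∈ B` of `f`, and `P₂` that of `q(t)`. -/
theorem exists_norm_mul_aeval_eq_of_model {t : C.RatFuncˣ}
    (hX : algebraMap B C.RatFunc (algebraMap k[X] B Polynomial.X) = t)
    (hN : ∀ b : B, (Algebra.norm k⟮t.1⟯ (algebraMap B C.RatFunc b)).1 =
      aeval t.1 (Algebra.norm k[X] b))
    {f : C.RatFuncˣ} (hf : ∀ Q, 0 < C.ord Q t → C.ord Q f = 0) :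
    ∃ P₁ P₂ : k[X], P₁.eval 0 ≠ 0 ∧ P₂.eval 0 ≠ 0 ∧
      (Algebra.norm k⟮t.1⟯ f.1).1 * aeval t.1 P₂ = aeval t.1 P₁ ∧
      (evalDiv f (regularPart t.1 (C.div (Additive.ofMul t))) : k) = P₁.eval 0 / P₂.eval 0 ∧
      ((∀ Q, C.ord Q t < 0 → C.ord Q f = 0) → (evalDiv t (C.div (Additive.ofMul f)) : k) =
        ((-1) ^ P₁.natDegree * (P₁.eval 0 / P₁.leadingCoeff)) /
          ((-1) ^ P₂.natDegree * (P₂.eval 0 / P₂.leadingCoeff))) := by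
  have ht (Q : C.ClosedPoint) := mem_valRing_iff_of_finite hX Q
  obtain ⟨b, q, hq, hb⟩ := exists_algebraMap_eq_mul_aeval hX hf
  have hinj : Function.Injective (algebraMap k[X] B) := FaithfulSMul.algebraMap_injective _ _
  have hu0 : aeval t.1 q ≠ 0 := by
    rw [← algebraMap_algebraMap_eq_aeval hX, Ne,
      map_eq_zero_iff _ (IsFractionRing.injective B C.RatFunc), map_eq_zero_iff _ hinj]
    rintro rfl
    exact hq eval_zero
  let f₂ : C.RatFuncˣ := Units.mk0 _ hu0
  have hf₂ : algebraMap B C.RatFunc (algebraMap k[X] B q) = f₂ :=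
    algebraMap_algebraMap_eq_aeval hX q
  have hf₁ : algebraMap B C.RatFunc b = (f * f₂ : C.RatFuncˣ) := hb
  have hf₂t (Q : C.ClosedPoint) (hQ : 0 < C.ord Q t) : C.ord Q f₂ = 0 :=
    ord_aeval_eq_zero hX rfl hq hQ
  have hf₁t (Q : C.ClosedPoint) (hQ : 0 < C.ord Q t) : C.ord Q (f * f₂) = 0 := by
    rw [ord_mul, hf Q hQ, hf₂t Q hQ, add_zero]
  have hpos (Q : C.ClosedPoint) (hQ : t.1 ∈ C.valRing Q) (hQ' : C.ord Q t ≠ 0) : 0 < C.ord Q t :=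
    lt_of_le_of_ne (ord_nonneg_iff.mpr hQ) hQ'.symm
  have hX0 : algebraMap k[X] B Polynomial.X ≠ 0 := by
    intro h
    exact t.ne_zero (by rw [← hX, h, map_zero])
  have hb0 : b ≠ 0 := by
    rintro rfl
    exact (f * f₂).ne_zero (by rw [← hf₁, map_zero])
  have hq0 : algebraMap k[X] B q ≠ 0 := by
    intro h
    exact f₂.ne_zero (by rw [← hf₂, h, map_zero])
  have := finite_quotient_span (k := k) hX0
  have := finite_quotient_span (k := k) hb0
  have := finite_quotient_span (k := k) hq0
  have e₁ := coe_evalDiv_regularPart_div ht hX hf₁ fun Q hQ hQ' => hf₁t Q (hpos Q hQ hQ')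
  have e₂ := coe_evalDiv_regularPart_div ht hX hf₂ fun Q hQ hQ' => hf₂t Q (hpos Q hQ hQ')
  rw [Algebra.norm_quotientX] at e₁ e₂
  refine ⟨Algebra.norm k[X] b, Algebra.norm k[X] (algebraMap k[X] B q), e₁ ▸ Units.ne_zero _,
    e₂ ▸ Units.ne_zero _, ?_, ?_, fun hf' => ?_⟩
  · rw [← hN, ← hN, hf₂, hf₁, Units.val_mul, map_mul]
    rfl
  · have hsupp (Q : C.ClosedPoint)
        (hQ : regularPart t.1 (C.div (Additive.ofMul t)) Q ≠ 0) : 0 < C.ord Q t := by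
      by_cases h : t.1 ∈ C.valRing Q
      · rw [regularPart_apply_of_mem h] at hQ
        exact hpos Q h hQ
      · exact absurd (regularPart_apply_of_notMem h _) hQ
    rw [eq_div_iff (e₂ ▸ Units.ne_zero _), ← e₁, ← e₂, ← Units.val_mul,
      ← evalDiv_mul (fun Q hQ => hf Q (hsupp Q hQ)) fun Q hQ => hf₂t Q (hsupp Q hQ)]
  · have hdiv : C.div (Additive.ofMul f) = regularPart t.1 (C.div (Additive.ofMul (f * f₂))) -
        regularPart t.1 (C.div (Additive.ofMul f₂)) := by
      refine eq_sub_of_add_eq ?_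
      rw [ofMul_mul, map_add, regularPart_add]
      congr 1
      ext Q
      by_cases h : t.1 ∈ C.valRing Q
      · rw [regularPart_apply_of_mem h]
      · rw [regularPart_apply_of_notMem h, div_apply]
        exact hf' Q (not_le.mp fun h' => h (ord_nonneg_iff.mp h'))
    have hdisj {f : C.RatFuncˣ} (hf : ∀ Q, 0 < C.ord Q t → C.ord Q f = 0) (Q : C.ClosedPoint)
        (hQ : t.1 ∈ C.valRing Q) (hQ' : C.ord Q f ≠ 0) : C.ord Q t = 0 := by
      by_contra h
      exact hQ' (hf Q (hpos Q hQ h))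
    rw [hdiv, evalDiv_sub, Units.val_div_eq_div_val,
      coe_evalDiv_regularPart_div ht hf₁ hX (hdisj hf₁t),
      coe_evalDiv_regularPart_div ht hf₂ hX (hdisj hf₂t), Algebra.norm_X_quotient_span hb0,
      Algebra.norm_X_quotient_span hq0]

theorem deg_regularPart_div_self {t : C.RatFuncˣ}
    (hX : algebraMap B C.RatFunc (algebraMap k[X] B Polynomial.X) = t) :
    C.deg (regularPart t.1 (C.div (Additive.ofMul t))) = Module.finrank k[X] B := by
  have hX0 : algebraMap k[X] B Polynomial.X ≠ 0 := by
    intro h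
    exact t.ne_zero (by rw [← hX, h, map_zero])
  have := finite_quotient_span (k := k) hX0
  rw [deg_regularPart_div (mem_valRing_iff_of_finite hX) hX, finrank_quotientX]

end PolynomialModel

/-- The model of the curve over the affine line given by a separating function: the integral closure
of `k[t]` in the function field. -/
theorem IsSeparating.exists_model {t : C.RatFunc} (ht : IsSeparating k t) :
    ∃ (B : Type u) (_ : CommRing B) (_ : IsDedekindDomain B) (_ : Algebra k B)
      (_ : Algebra B C.RatFunc) (_ : Algebra k[X] B), IsFractionRing B C.RatFunc ∧
      IsScalarTower k B C.RatFunc ∧ IsScalarTower k k[X] B ∧ Module.Finite k[X] B ∧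
      Module.Free k[X] B ∧ algebraMap B C.RatFunc (algebraMap k[X] B Polynomial.X) = t ∧
      (∀ b : B, (Algebra.norm k⟮t⟯ (algebraMap B C.RatFunc b)).1 = aeval t (Algebra.norm k[X] b)) ∧
      Module.finrank k[X] B = Module.finrank k⟮t⟯ C.RatFunc := by
  obtain ⟨ht, _, _⟩ := ht
  let := aevalAdjoinAlgebra (k := k) t
  let := aevalAlgebra (k := k) t
  have := aevalAdjoinAlgebra_isScalarTower (k := k) t
  have := aevalAlgebra_isScalarTower (k := k) t
  have := aevalAdjoinAlgebra_isFractionRing ht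
  have : Module.IsTorsionFree k[X] C.RatFunc := .trans_faithfulSMul k[X] k⟮t⟯ C.RatFunc
  let B := integralClosure k[X] C.RatFunc
  have h1 : IsDedekindDomain B := IsIntegralClosure.isDedekindDomain k[X] k⟮t⟯ C.RatFunc B
  have h2 : IsFractionRing B C.RatFunc :=
    IsIntegralClosure.isFractionRing_of_finite_extension k[X] k⟮t⟯ C.RatFunc B
  have h3 : Module.Finite k[X] B := IsIntegralClosure.finite k[X] k⟮t⟯ C.RatFunc B
  have h4 : Module.Free k[X] B := IsIntegralClosure.module_free k[X] k⟮t⟯ C.RatFunc B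
  refine ⟨B, inferInstance, h1, inferInstance, inferInstance, inferInstance, h2, inferInstance,
    inferInstance, h3, h4, aeval_X t, fun b => ?_, ?_⟩
  · have : IsLocalization (Algebra.algebraMapSubmonoid B (nonZeroDivisors k[X])) C.RatFunc :=
      IsIntegralClosure.isLocalization k[X] k⟮t⟯ C.RatFunc B
    rw [Algebra.norm_localization k[X] (nonZeroDivisors k[X])]
    exact (IsScalarTower.algebraMap_apply k[X] k⟮t⟯ C.RatFunc _).symm
  · exact (IsIntegralClosure.rank k[X] k⟮t⟯ C.RatFunc B)

/-- Let `P₁(t) / P₂(t)` be the norm of `f` to the field `k(t)`. The value of `f` on the zeros of `t`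
is `P₁(0) / P₂(0)`, and that of `t` on the divisor of `f` is given by the quotients of the constant
and leading coefficients, provided that no pole of `t` is in the support of that divisor. -/
theorem IsSeparating.exists_norm_mul_aeval_eq {t : C.RatFuncˣ} (ht : IsSeparating k t.1)
    {f : C.RatFuncˣ} (hf : ∀ Q, 0 < C.ord Q t → C.ord Q f = 0) :
    ∃ P₁ P₂ : k[X], P₁.eval 0 ≠ 0 ∧ P₂.eval 0 ≠ 0 ∧
      (Algebra.norm k⟮t.1⟯ f.1).1 * aeval t.1 P₂ = aeval t.1 P₁ ∧
      (evalDiv f (regularPart t.1 (C.div (Additive.ofMul t))) : k) = P₁.eval 0 / P₂.eval 0 ∧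
      ((∀ Q, C.ord Q t < 0 → C.ord Q f = 0) → (evalDiv t (C.div (Additive.ofMul f)) : k) =
        ((-1) ^ P₁.natDegree * (P₁.eval 0 / P₁.leadingCoeff)) /
          ((-1) ^ P₂.natDegree * (P₂.eval 0 / P₂.leadingCoeff))) := by
  obtain ⟨B, _, _, _, _, _, _, _, _, _, _, hX, hN, -⟩ := IsSeparating.exists_model ht
  exact exists_norm_mul_aeval_eq_of_model hX hN hf

/-- The degree of the divisor of zeros of `t` is the degree of the function field over `k(t)`. -/
theorem IsSeparating.deg_regularPart_div {t : C.RatFuncˣ} (ht : IsSeparating k t.1) :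
    C.deg (regularPart t.1 (C.div (Additive.ofMul t))) = Module.finrank k⟮t.1⟯ C.RatFunc := by
  obtain ⟨B, _, _, _, _, _, _, _, _, _, _, hX, -, h⟩ := IsSeparating.exists_model ht
  rw [deg_regularPart_div_self hX, h]

theorem adjoin_simple_inv (t : C.RatFunc) : k⟮t⁻¹⟯ = k⟮t⟯ := by
  refine le_antisymm ?_ ?_
  · rw [adjoin_simple_le_iff]
    exact inv_mem (mem_adjoin_simple_self k t)
  · rw [adjoin_simple_le_iff]
    simpa using inv_mem (mem_adjoin_simple_self k t⁻¹)

theorem IsSeparating.inv {t : C.RatFunc} (ht : IsSeparating k t) : IsSeparating k t⁻¹ := by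
  obtain ⟨h1, h2, h3⟩ := ht
  refine ⟨fun h => h1 (by simpa using h.inv), ?_, ?_⟩
  · rwa [adjoin_simple_inv]
  · rwa [adjoin_simple_inv]

/-- A principal divisor is the difference of the divisor of zeros and the divisor of poles. -/
theorem div_eq_sub_regularPart (t : C.RatFuncˣ) : C.div (Additive.ofMul t) =
    regularPart t.1 (C.div (Additive.ofMul t)) -
      regularPart (t⁻¹).1 (C.div (Additive.ofMul t⁻¹)) := by
  ext Q
  rw [Finsupp.sub_apply]
  have h1 : t.1 ∈ C.valRing Q ↔ 0 ≤ C.ord Q t := ord_nonneg_iff.symm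
  have h2 : (t⁻¹).1 ∈ C.valRing Q ↔ 0 ≤ - C.ord Q t := by rw [← ord_inv, ord_nonneg_iff]
  by_cases h : t.1 ∈ C.valRing Q <;> by_cases h' : (t⁻¹).1 ∈ C.valRing Q
  · rw [regularPart_apply_of_mem h, regularPart_apply_of_mem h', div_apply, div_apply, ord_inv]
    rw [h1] at h; rw [h2] at h'
    lia
  · rw [regularPart_apply_of_mem h, regularPart_apply_of_notMem h', sub_zero]
  · rw [regularPart_apply_of_notMem h, regularPart_apply_of_mem h', div_apply, div_apply, ord_inv]
    lia
  · rw [h1] at h; rw [h2] at h'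
    lia

theorem IsSeparating.deg_div {t : C.RatFuncˣ} (ht : IsSeparating k t.1) :
    C.deg (C.div (Additive.ofMul t)) = 0 := by
  have ht' : IsSeparating k (t⁻¹).1 := by
    rw [Units.val_inv_eq_inv_val]
    exact IsSeparating.inv ht
  rw [div_eq_sub_regularPart, map_sub, IsSeparating.deg_regularPart_div ht,
    IsSeparating.deg_regularPart_div ht', Units.val_inv_eq_inv_val, adjoin_simple_inv, sub_self]

/-- Comparison of the behaviour at infinity of two expressions of a rational function. -/
theorem natDegree_eq_and_leadingCoeff_mul_eq {K : Type*} [Field K] [Algebra k K] {t : K}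
    (ht : Transcendental k t) {P₁ P₂ R₁ R₂ : k[X]} (hR₁ : R₁.eval 0 ≠ 0) (hR₂ : R₂.eval 0 ≠ 0)
    (hP₁ : P₁ ≠ 0) (hP₂ : P₂ ≠ 0)
    (h : aeval t P₁ * aeval t⁻¹ R₂ = aeval t P₂ * aeval t⁻¹ R₁) :
    P₁.natDegree = P₂.natDegree ∧
      P₁.leadingCoeff * R₂.eval 0 = P₂.leadingCoeff * R₁.eval 0 := by
  have ht0 : t ≠ 0 := by
    rintro rfl
    exact ht isAlgebraic_zero
  -- Multiplication by `t ^ M` turns the identity into one of polynomials.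
  let M := max R₁.natDegree R₂.natDegree
  have hrev {R : k[X]} (hR : R.natDegree ≤ M) :
      aeval t⁻¹ R * t ^ M = aeval t (R.reflect M) := by
    have := invertibleOfNonzero ht0
    rw [aeval_def, aeval_def, ← eval₂_reflect_mul_pow (algebraMap k K) t M (R.reflect M),
      reflect_reflect, invOf_eq_inv]
    exact natDegree_reflect_le.trans (by simp [hR])
  have hdeg {R : k[X]} (hR : R.natDegree ≤ M) (hR0 : R.eval 0 ≠ 0) :
      (R.reflect M).natDegree = M ∧ (R.reflect M).leadingCoeff = R.eval 0 := by
    have h1 : (R.reflect M).coeff M = R.eval 0 := by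
      rw [coeff_reflect, revAt_le le_rfl, Nat.sub_self, coeff_zero_eq_eval_zero]
    have h2 : (R.reflect M).natDegree = M := le_antisymm
      (natDegree_reflect_le.trans (by simp [hR])) (le_natDegree_of_ne_zero (h1 ▸ hR0))
    exact ⟨h2, by rw [leadingCoeff, h2, h1]⟩
  have hpoly : P₁ * R₂.reflect M = P₂ * R₁.reflect M := by
    refine transcendental_iff_injective.mp ht ?_
    rw [map_mul, map_mul, ← hrev (le_max_right _ _), ← hrev (le_max_left _ _), ← mul_assoc, h,
      mul_assoc]
  obtain ⟨d₁, l₁⟩ := hdeg (le_max_left _ _) hR₁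
  obtain ⟨d₂, l₂⟩ := hdeg (le_max_right _ _) hR₂
  have n₁ : R₁.reflect M ≠ 0 := fun h => hR₁ (by rw [← l₁, h, leadingCoeff_zero])
  have n₂ : R₂.reflect M ≠ 0 := fun h => hR₂ (by rw [← l₂, h, leadingCoeff_zero])
  refine ⟨?_, ?_⟩
  · have := congr_arg natDegree hpoly
    rw [natDegree_mul hP₁ n₂, natDegree_mul hP₂ n₁, d₁, d₂] at this
    lia
  · have := congr_arg leadingCoeff hpoly
    rwa [leadingCoeff_mul, leadingCoeff_mul, l₁, l₂] at this

/-- Weil reciprocity `f(div t) = t(div f)` for a separating function `t` and a function `f` whose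
divisor is disjoint from that of `t`. -/
theorem IsSeparating.evalDiv_div {t : C.RatFuncˣ} (ht : IsSeparating k t.1)
    {f : C.RatFuncˣ} (hf : ∀ Q, C.ord Q t ≠ 0 → C.ord Q f = 0) :
    evalDiv f (C.div (Additive.ofMul t)) = evalDiv t (C.div (Additive.ofMul f)) := by
  have ht' : IsSeparating k (t⁻¹).1 := by
    rw [Units.val_inv_eq_inv_val]
    exact IsSeparating.inv ht
  obtain ⟨P₁, P₂, hP₁, hP₂, hP, eP, eP'⟩ := IsSeparating.exists_norm_mul_aeval_eq ht
    (f := f) fun Q hQ => hf Q hQ.ne'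
  obtain ⟨R₁, R₂, hR₁, hR₂, hR, eR, -⟩ := IsSeparating.exists_norm_mul_aeval_eq ht'
    (f := f) fun Q hQ => hf Q fun h => by rw [ord_inv, h] at hQ; exact absurd hQ (by simp)
  have hnorm : (Algebra.norm k⟮(t⁻¹).1⟯ f.1).1 = (Algebra.norm k⟮t.1⟯ f.1).1 := by
    rw [Units.val_inv_eq_inv_val]
    exact congr_arg (fun F : IntermediateField k C.RatFunc => (Algebra.norm F f.1).1)
      (adjoin_simple_inv t.1)
  rw [hnorm, Units.val_inv_eq_inv_val] at hR
  have hP₁0 : P₁ ≠ 0 := fun h => hP₁ (h ▸ eval_zero)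
  have hP₂0 : P₂ ≠ 0 := fun h => hP₂ (h ▸ eval_zero)
  obtain ⟨hd, hl⟩ := natDegree_eq_and_leadingCoeff_mul_eq ht.1 hR₁ hR₂ hP₁0 hP₂0
    (by rw [← hP, ← hR]; ring)
  -- As `P₁` and `P₂` have the same degree, the signs cancel.
  refine Units.ext ?_
  rw [eP' fun Q hQ => hf Q hQ.ne, div_eq_sub_regularPart, evalDiv_sub, Units.val_div_eq_div_val,
    eP, eR, hd]
  have l₁ := leadingCoeff_ne_zero.mpr hP₁0
  have l₂ := leadingCoeff_ne_zero.mpr hP₂0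
  field_simp
  linear_combination hl

end SmoothProperCurve

/-! ### Weak approximation, Weil reciprocity and constants -/

namespace SmoothProperCurve
variable {k : Type u} [Field k] {C : SmoothProperCurve k}

open Classical in
/-- The absolute value `2 ^ (-ord_Q)` of the function field. -/
noncomputable def absoluteValue (Q : C.ClosedPoint) : AbsoluteValue C.RatFunc ℝ where
  toFun f := if h : f = 0 then 0 else 2 ^ (-C.ord Q (Units.mk0 f h))
  map_mul' f g := by
    by_cases hf : f = 0
    · simp [hf]
    by_cases hg : g = 0
    · simp [hg]
    rw [dif_neg hf, dif_neg hg, dif_neg (mul_ne_zero hf hg), Units.mk0_mul, ord_mul,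
      ← zpow_add₀ two_ne_zero, neg_add]
  nonneg' f := by
    by_cases hf : f = 0
    · rw [dif_pos hf]
    · rw [dif_neg hf]
      positivity
  eq_zero' f := by
    refine ⟨fun h => ?_, fun h => dif_pos h⟩
    by_contra hf
    rw [dif_neg hf] at h
    exact zpow_ne_zero _ two_ne_zero h
  add_le' f g := by
    by_cases hf : f = 0
    · simp [hf]
    by_cases hg : g = 0
    · simp [hg]
    rw [dif_neg hf, dif_neg hg]
    by_cases hfg : f + g = 0
    · rw [dif_pos hfg]
      positivity
    rw [dif_neg hfg]
    have h := ord_min_le_add Q (f := Units.mk0 f hf) (g := Units.mk0 g hg)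
      (h := Units.mk0 (f + g) hfg) rfl
    have h2 (n m : ℤ) (h : n ≤ m) : (2 : ℝ) ^ (-m) ≤ 2 ^ (-n) :=
      zpow_le_zpow_right₀ one_le_two (by lia)
    have h0 (n : ℤ) : (0 : ℝ) ≤ 2 ^ n := by positivity
    obtain h | h := min_le_iff.mp h
    · exact (h2 _ _ h).trans (le_add_of_nonneg_right (h0 _))
    · exact (h2 _ _ h).trans (le_add_of_nonneg_left (h0 _))

theorem absoluteValue_apply (Q : C.ClosedPoint) (f : C.RatFuncˣ) :
    absoluteValue Q f.1 = 2 ^ (-C.ord Q f) := by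
  refine (dif_neg f.ne_zero).trans ?_
  congr
  exact Units.ext rfl

theorem absoluteValue_le_one_iff {Q : C.ClosedPoint} {f : C.RatFunc} :
    absoluteValue Q f ≤ 1 ↔ f ∈ C.valRing Q := by
  obtain rfl | hf := eq_or_ne f 0
  · simp
  lift f to C.RatFuncˣ using hf.isUnit
  rw [absoluteValue_apply, ← ord_nonneg_iff, zpow_le_one_iff_right₀ one_lt_two, neg_nonpos]

/-- Weak approximation: orders at finitely many closed points can be prescribed. -/
theorem exists_ord_eq (S : Finset C.ClosedPoint) (a : C.ClosedPoint → ℤ) :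
    ∃ h : C.RatFuncˣ, ∀ Q ∈ S, C.ord Q h = a Q := by
  obtain rfl | ⟨Q₀, hQ₀⟩ := S.eq_empty_or_nonempty
  · exact ⟨1, by simp⟩
  choose π hπ using exists_isUniformizer (C := C)
  have hdense := AbsoluteValue.denseRange_algebraMap_pi (F := C.RatFunc) (ι := S)
    (v := fun Q => absoluteValue Q.1)
    (fun Q => ⟨π Q, (π Q).ne_zero, by
      rw [absoluteValue_apply, hπ]
      norm_num⟩)
    (fun Q Q' hne h => hne (Subtype.ext (C.valRing_injective (by
      ext f
      rw [← absoluteValue_le_one_iff, ← absoluteValue_le_one_iff]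
      exact h.le_one_iff))))
  -- A function that is close to `π Q ^ a Q` at `Q` has the same order there.
  let z (Q : C.ClosedPoint) : C.RatFuncˣ := π Q ^ a Q
  have hz (Q : C.ClosedPoint) : C.ord Q (z Q) = a Q := by
    rw [ord_zpow, hπ, mul_one]
  obtain ⟨r, hr0, hr⟩ : ∃ r : ℝ, 0 < r ∧ ∀ Q ∈ S, r ≤ absoluteValue Q (z Q).1 := by
    refine ⟨S.inf' ⟨Q₀, hQ₀⟩ fun Q => absoluteValue Q (z Q).1, ?_, fun Q hQ => Finset.inf'_le _ hQ⟩
    exact (Finset.lt_inf'_iff _).mpr fun Q _ => (absoluteValue Q).pos (z Q).ne_zero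
  obtain ⟨f, hf⟩ := Metric.denseRange_iff.mp hdense
    (fun Q => WithAbs.toAbs (absoluteValue Q.1) (z Q.1).1) r hr0
  rw [dist_pi_lt_iff hr0] at hf
  have hlt (Q : C.ClosedPoint) (hQ : Q ∈ S) :
      absoluteValue Q ((z Q).1 - f) < absoluteValue Q (z Q).1 := by
    refine lt_of_lt_of_le ?_ (hr Q hQ)
    have := hf ⟨Q, hQ⟩
    rw [dist_eq_norm] at this
    exact this
  have hf0 : f ≠ 0 := by
    rintro rfl
    exact absurd (hlt Q₀ hQ₀) (by rw [sub_zero]; exact lt_irrefl _)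
  lift f to C.RatFuncˣ using hf0.isUnit
  refine ⟨f, fun Q hQ => ?_⟩
  by_cases hzf : (z Q).1 - f.1 = 0
  · rw [← hz Q, Units.ext (sub_eq_zero.mp hzf)]
  let d : C.RatFuncˣ := Units.mk0 _ hzf
  have hd : C.ord Q (z Q) < C.ord Q d := by
    have h := hlt Q hQ
    rw [show (z Q).1 - f.1 = d.1 from rfl, absoluteValue_apply, absoluteValue_apply,
      zpow_lt_zpow_iff_right₀ one_lt_two] at h
    lia
  have hneg : C.ord Q (-d) = C.ord Q d := by
    have h := ord_mul Q (-d) (-d)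
    rw [neg_mul_neg, ord_mul] at h
    lia
  have h1 := ord_min_le_add Q (f := z Q) (g := -d) (h := f) (by
    rw [Units.val_neg]
    change (z Q).1 + -((z Q).1 - f.1) = f.1
    ring)
  have h2 := ord_min_le_add Q (f := f) (g := d) (h := z Q) (by
    change f.1 + ((z Q).1 - f.1) = (z Q).1
    ring)
  rw [hz] at *
  lia

theorem ord_one_add {Q : C.ClosedPoint} {f g : C.RatFuncˣ} (hf : 0 < C.ord Q f)
    (hg : 1 + f.1 = g.1) : C.ord Q g = 0 := by
  obtain ⟨a, ha⟩ := ord_nonneg_iff.mp hf.le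
  rw [ord_pos_iff ha] at hf
  have h1 : IsUnit (1 + a) := by
    by_contra h
    have := (IsLocalRing.maximalIdeal (C.X.presheaf.stalk Q.1)).sub_mem
      ((IsLocalRing.mem_maximalIdeal _).mpr h) hf
    rw [add_sub_cancel_right] at this
    exact (Ideal.ne_top_iff_one _).mp (Ideal.IsPrime.ne_top') this
  refine ord_eq_zero_iff.mpr ⟨h1.unit, ?_⟩
  rw [IsUnit.unit_spec, map_add, map_one, ha, hg]

/-- A non-zero derivation does not vanish on all functions that have order zero at given finitely
many closed points. -/
theorem exists_ord_eq_zero_derivation_ne_zero (S : Finset C.ClosedPoint)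
    (D : Derivation k C.RatFunc C.RatFunc) {x : C.RatFuncˣ} (hx : D x.1 ≠ 0) :
    ∃ h : C.RatFuncˣ, (∀ Q ∈ S, C.ord Q h = 0) ∧ D h.1 ≠ 0 := by
  -- Both `h` and `h * x` vanish on `S`, and not both derivatives are zero; so `1 + h` or `1 + h * x`
  -- has the required properties.
  obtain ⟨h, hh⟩ := exists_ord_eq S fun Q => 1 + |C.ord Q x|
  have hunit (f : C.RatFuncˣ) (hf : ∀ Q ∈ S, 0 < C.ord Q f) (hD : D f.1 ≠ 0) :
      ∃ h : C.RatFuncˣ, (∀ Q ∈ S, C.ord Q h = 0) ∧ D h.1 ≠ 0 := by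
    have hD' : D (1 + f.1) ≠ 0 := by rwa [map_add, D.map_one_eq_zero, zero_add]
    have h0 : 1 + f.1 ≠ 0 := fun h => hD' (by rw [h, map_zero])
    exact ⟨Units.mk0 _ h0, fun Q hQ => ord_one_add (hf Q hQ) rfl, hD'⟩
  by_cases hD : D h.1 = 0
  · refine hunit (h * x) (fun Q hQ => ?_) ?_
    · rw [ord_mul, hh Q hQ]
      have := neg_abs_le (C.ord Q x)
      lia
    · rw [Units.val_mul, D.leibniz, hD, smul_zero, add_zero]
      exact mul_ne_zero h.ne_zero hx
  · refine hunit h (fun Q hQ => ?_) hD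
    rw [hh Q hQ]
    have := abs_nonneg (C.ord Q x)
    lia

variable (C) in
/-- There is a derivation of the function field that detects separating functions. -/
theorem exists_isSeparating_derivation : ∃ (x : C.RatFuncˣ) (D : Derivation k C.RatFunc C.RatFunc),
    D x.1 ≠ 0 ∧ ∀ t : C.RatFunc, D t ≠ 0 → IsSeparating k t := by
  obtain ⟨x, hx⟩ := C.exists_isSeparating
  obtain ⟨D, hD⟩ := _root_.IsSeparating.exists_derivation hx
  have hx0 : x ≠ 0 := by
    rintro rfl
    exact hD (map_zero D)
  exact ⟨Units.mk0 x hx0, D, hD, fun t ht => hx.of_derivation D ht⟩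

/-- Principal divisors have degree zero. -/
theorem deg_div (f : C.RatFuncˣ) : C.deg (C.div (Additive.ofMul f)) = 0 := by
  obtain ⟨x, D, hD, hsep⟩ := C.exists_isSeparating_derivation
  by_cases hf : D f.1 = 0
  · have h1 : D (f * x).1 ≠ 0 := by
      rw [Units.val_mul, D.leibniz, hf, smul_zero, add_zero]
      exact mul_ne_zero f.ne_zero hD
    have h2 := IsSeparating.deg_div (hsep _ h1)
    rwa [ofMul_mul, map_add, map_add, IsSeparating.deg_div (hsep _ hD), add_zero] at h2
  · exact IsSeparating.deg_div (hsep _ hf)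

/-- Weil reciprocity for functions with disjoint divisors. If `g` is not known to be separating, it
is a quotient `(g * u) / u` of separating functions. -/
theorem evalDiv_div_comm {f g : C.RatFuncˣ} (h : ∀ Q, C.ord Q g ≠ 0 → C.ord Q f = 0) :
    evalDiv f (C.div (Additive.ofMul g)) = evalDiv g (C.div (Additive.ofMul f)) := by
  obtain ⟨x, D, hD, hsep⟩ := C.exists_isSeparating_derivation
  by_cases hg : D g.1 = 0
  · obtain ⟨u, hu, hDu⟩ := exists_ord_eq_zero_derivation_ne_zero
      (C.div (Additive.ofMul f)).support D hD
    have hu' (Q : C.ClosedPoint) (hQ : C.ord Q f ≠ 0) : C.ord Q u = 0 :=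
      hu Q (Finsupp.mem_support_iff.mpr hQ)
    have hDgu : D (g * u).1 ≠ 0 := by
      rw [Units.val_mul, D.leibniz, hg, smul_zero, add_zero]
      exact mul_ne_zero g.ne_zero hDu
    have h' (Q : C.ClosedPoint) (hQ : C.ord Q f ≠ 0) : C.ord Q g = 0 := by
      by_contra hg
      exact hQ (h Q hg)
    have h1 := IsSeparating.evalDiv_div (hsep _ hDu) (f := f) fun Q hQ => by
      by_contra hf
      exact hQ (hu' Q hf)
    have h2 := IsSeparating.evalDiv_div (hsep _ hDgu) (f := f) fun Q hQ => by
      by_contra hf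
      exact hQ (by rw [ord_mul, hu' Q hf, h' Q hf, add_zero])
    rw [ofMul_mul, map_add, evalDiv_add, evalDiv_mul h' hu', h1] at h2
    exact mul_right_cancel h2
  · exact IsSeparating.evalDiv_div (hsep _ hg) h

/-- A rational function without zeros and poles is algebraic over the ground field. -/
theorem isIntegral_of_div_eq_zero {c : C.RatFuncˣ} (hc : C.div (Additive.ofMul c) = 0) :
    IsIntegral k c.1 := by
  by_contra h
  -- A function that is not integral has a pole, as every valuation ring is that of a closed point.
  obtain ⟨V, hV, hcV⟩ := Subring.exists_le_valuationSubring_of_isIntegrallyClosedIn (x := c.1)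
    (R := (integralClosure k C.RatFunc).toSubring) h
  have hV1 : V ≠ ⊤ := by
    rintro rfl
    exact hcV (ValuationSubring.mem_top _)
  obtain ⟨Q, rfl⟩ := C.exists_valRing_eq V (fun a => hV isIntegral_algebraMap) hV1
  exact hcV (ord_nonneg_iff.mp (DFunLike.congr_fun hc Q).ge)

/-- A rational function without zeros and poles has the value `1` on all divisors of degree zero. -/
theorem evalDiv_eq_one_of_div_eq_zero {c : C.RatFuncˣ} (hc : C.div (Additive.ofMul c) = 0)
    {E : C.Div} (hE : E ∈ C.Div0) : evalDiv c E = 1 := by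
  have hint := isIntegral_of_div_eq_zero hc
  have hc0 (Q : C.ClosedPoint) : C.ord Q c = 0 := DFunLike.congr_fun hc Q
  let F := k⟮c.1⟯
  have : FiniteDimensional k F := adjoin.finiteDimensional hint
  have hQ (Q : C.ClosedPoint) (a : F) : algebraMap F C.RatFunc a ∈ C.valRing Q := by
    have h1 : IsIntegral k (algebraMap F C.RatFunc a) :=
      (Algebra.IsIntegral.isIntegral (R := k) a).algebraMap
    exact IsIntegrallyClosed.isIntegral_iff.mp (h1.tower_top (A := C.X.presheaf.stalk Q.1))
  let c' : F := ⟨c.1, mem_adjoin_simple_self k c.1⟩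
  have hc' : c' ≠ 0 := fun h => c.ne_zero (congr_arg Subtype.val h)
  have hex (Q : C.ClosedPoint) : ∃ e : ℕ,
      Module.finrank k (C.ResidueField Q) = Module.finrank k F * e ∧
      Algebra.norm k (C.valueAt Q c).1 = Algebra.norm k c' ^ e := by
    let φ : F →ₐ[k] C.ResidueField Q :=
      (IsScalarTower.toAlgHom k (C.X.presheaf.stalk Q.1) (C.ResidueField Q)).comp (toStalk (hQ Q))
    let := φ.toRingHom.toAlgebra
    have : IsScalarTower k F (C.ResidueField Q) := .of_algebraMap_eq' φ.comp_algebraMap.symm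
    refine ⟨Module.finrank F (C.ResidueField Q), (Module.finrank_mul_finrank _ _ _).symm, ?_⟩
    obtain ⟨w, hw⟩ := ord_eq_zero_iff.mp (hc0 Q)
    have h1 : w.1 = toStalk (hQ Q) c' := by
      apply IsFractionRing.injective (C.X.presheaf.stalk Q.1) C.RatFunc
      rw [hw, algebraMap_toStalk]
      rfl
    have h2 : (C.valueAt Q c).1 = algebraMap F _ c' := by
      rw [valueAt_eq w hw]
      exact congr_arg (algebraMap _ (C.ResidueField Q)) h1
    rw [h2, ← Algebra.norm_norm (S := F), Algebra.norm_algebraMap, map_pow]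
  -- The norm of the value of `c` at `Q` is `N(c) ^ [k(Q) : F]`, and the degree of `Q` is
  -- `[F : k] * [k(Q) : F]`.
  choose e he using hex
  have hn : Algebra.norm k c' ≠ 0 := Algebra.norm_ne_zero_iff.mpr hc'
  let N : kˣ := Units.mk0 _ hn
  have hsum : (E.sum fun Q m => m * (e Q : ℤ)) = 0 := by
    have h1 : C.deg E = 0 := hE
    rw [deg_apply, Finsupp.sum] at h1
    have h2 : (Module.finrank k F : ℤ) * (E.sum fun Q m => m * (e Q : ℤ)) = 0 := by
      rw [← h1, Finsupp.sum, Finset.mul_sum]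
      refine Finset.sum_congr rfl fun Q _ => ?_
      rw [(he Q).1, Nat.cast_mul]
      ring
    exact (mul_eq_zero.mp h2).resolve_left (by exact_mod_cast Module.finrank_pos.ne')
  rw [evalDiv, Finsupp.prod]
  calc _ = ∏ Q ∈ E.support, N ^ (E Q * (e Q : ℤ)) := by
        refine Finset.prod_congr rfl fun Q _ => ?_
        have : Units.map (Algebra.norm k : C.ResidueField Q →* k) (C.valueAt Q c) = N ^ e Q :=
          Units.ext ((he Q).2.trans (by rw [Units.val_pow_eq_pow_val]; rfl))
        rw [this, ← zpow_natCast, ← zpow_mul, mul_comm]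
    _ = N ^ (E.sum fun Q m => m * (e Q : ℤ)) := by
        rw [Finsupp.sum]
        classical
        induction E.support using Finset.induction_on with
        | empty => simp
        | insert Q s hQ ih => rw [Finset.prod_insert hQ, Finset.sum_insert hQ, zpow_add, ih]
    _ = 1 := by rw [hsum, zpow_zero]

end SmoothProperCurve

/-! ### The pairing -/

section UnitsQModZ

variable {F : Type u} [Field F]

/-- The homomorphism `u ↦ u ⊗ 1/n`. -/
noncomputable def tmulInv (n : ℕ) : Additive Fˣ →+ UnitsQModZ F :=
  ((TensorProduct.mk ℤ (Additive Fˣ) QModZ).flip (((n : ℚ)⁻¹ : ℚ) : QModZ)).toAddMonoidHom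

theorem tmulInv_apply (n : ℕ) (u : Additive Fˣ) :
    tmulInv n u = u ⊗ₜ[ℤ] (((n : ℚ)⁻¹ : ℚ) : QModZ) := rfl

theorem nsmul_tmulInv_mul {n m : ℕ} (hm : 0 < m) (u : Additive Fˣ) :
    m • tmulInv (n * m) u = tmulInv n u := by
  have h : m • (((n * m : ℕ) : ℚ)⁻¹ : ℚ) = (n : ℚ)⁻¹ := by
    rw [nsmul_eq_mul, Nat.cast_mul]
    field_simp
  rw [tmulInv_apply, tmulInv_apply, ← h, ← TensorProduct.tmul_smul]
  rfl

theorem tmulInv_mul_pow {n m : ℕ} (hm : 0 < m) (u : Fˣ) :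
    tmulInv (n * m) (Additive.ofMul (u ^ m)) = tmulInv n (Additive.ofMul u) := by
  rw [ofMul_pow, map_nsmul, nsmul_tmulInv_mul hm]

theorem tmulInv_one (u : Additive Fˣ) : tmulInv 1 u = 0 := by
  have h : ((((1 : ℕ) : ℚ)⁻¹ : ℚ) : QModZ) = 0 :=
    (QuotientAddGroup.eq_zero_iff _).mpr (AddSubgroup.mem_zmultiples_iff.mpr ⟨1, by simp⟩)
  rw [tmulInv_apply, h, TensorProduct.tmul_zero]

theorem nsmul_tmulInv_self {n : ℕ} (hn : 0 < n) (u : Additive Fˣ) : n • tmulInv n u = 0 := by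
  rw [← tmulInv_one u, ← nsmul_tmulInv_mul (n := 1) hn u, one_mul]

theorem tmulInv_pow_self {n : ℕ} (hn : 0 < n) (u : Fˣ) :
    tmulInv n (Additive.ofMul (u ^ n)) = 0 := by
  rw [ofMul_pow, map_nsmul, nsmul_tmulInv_self hn]

end UnitsQModZ

namespace SmoothProperCurve
variable {k : Type u} [Field k] {C : SmoothProperCurve k}

theorem ord_div_zpow {Q : C.ClosedPoint} {π : C.RatFuncˣ} (hπ : C.IsUniformizer Q π)
    (f : C.RatFuncˣ) : C.ord Q (f / π ^ C.ord Q f) = 0 := by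
  rw [ord_div, ord_zpow, hπ, mul_one, sub_self]

theorem lc_eq (Q : C.ClosedPoint) (π f : C.RatFuncˣ) (n : ℕ) :
    C.lc Q π f n = tmulInv n (Additive.ofMul (C.valueAt Q (f / π ^ C.ord Q f))) := rfl

theorem lc_mul {Q : C.ClosedPoint} {π : C.RatFuncˣ} (hπ : C.IsUniformizer Q π)
    (f g : C.RatFuncˣ) (n : ℕ) : C.lc Q π (f * g) n = C.lc Q π f n + C.lc Q π g n := by
  rw [lc_eq, lc_eq, lc_eq, ← map_add, ← ofMul_mul,
    ← valueAt_mul (ord_div_zpow hπ f) (ord_div_zpow hπ g), ord_mul, zpow_add, mul_div_mul_comm]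

theorem lc_pow_self {Q : C.ClosedPoint} {π : C.RatFuncˣ} (hπ : C.IsUniformizer Q π)
    (f : C.RatFuncˣ) {n : ℕ} (hn : 0 < n) : C.lc Q π (f ^ n) n = 0 := by
  have h : f ^ n / π ^ C.ord Q (f ^ n) = (f / π ^ C.ord Q f) ^ n := by
    rw [ord_pow, div_pow, mul_comm, zpow_mul, zpow_natCast]
  rw [lc_eq, h, valueAt_pow (ord_div_zpow hπ f), tmulInv_pow_self hn]

theorem normMap_lc (Q : C.ClosedPoint) (π f : C.RatFuncˣ) (n : ℕ) :
    C.normMap Q (C.lc Q π f n) = tmulInv n (Additive.ofMul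
      (Units.map (Algebra.norm k : C.ResidueField Q →* k) (C.valueAt Q (f / π ^ C.ord Q f)))) :=
  rfl

variable {π : C.ClosedPoint → C.RatFuncˣ}

theorem pairingExpr_add (π : C.ClosedPoint → C.RatFuncˣ) (n : ℕ) (f : C.RatFuncˣ) (E E' : C.Div) :
    C.pairingExpr π n f (E + E') = C.pairingExpr π n f E + C.pairingExpr π n f E' := by
  classical
  exact Finsupp.sum_add_index' (fun _ => zero_smul _ _) fun _ _ _ => add_smul _ _ _

theorem pairingExpr_mul (hπ : ∀ Q, C.IsUniformizer Q (π Q)) (n : ℕ) (f g : C.RatFuncˣ)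
    (E : C.Div) :
    C.pairingExpr π n (f * g) E = C.pairingExpr π n f E + C.pairingExpr π n g E := by
  rw [pairingExpr, pairingExpr, pairingExpr, ← Finsupp.sum_add]
  exact Finsupp.sum_congr fun Q _ => by rw [lc_mul (hπ Q), map_add, smul_add]

theorem pairingExpr_pow_self (hπ : ∀ Q, C.IsUniformizer Q (π Q)) {n : ℕ} (hn : 0 < n)
    (f : C.RatFuncˣ) (E : C.Div) : C.pairingExpr π n (f ^ n) E = 0 := by
  rw [pairingExpr, Finsupp.sum]
  exact Finset.sum_eq_zero fun Q _ => by rw [lc_pow_self (hπ Q) f hn, map_zero, smul_zero]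

/-- If `f` has order zero on the support of `E`, the pairing is `f(E) ⊗ 1/n`, and no uniformizers
are needed. -/
theorem pairingExpr_eq_tmulInv (π : C.ClosedPoint → C.RatFuncˣ) (n : ℕ) {f : C.RatFuncˣ}
    {E : C.Div} (hf : ∀ Q, E Q ≠ 0 → C.ord Q f = 0) :
    C.pairingExpr π n f E = tmulInv n (Additive.ofMul (evalDiv f E)) := by
  rw [pairingExpr, evalDiv, Finsupp.sum, Finsupp.prod, ofMul_prod, map_sum]
  refine Finset.sum_congr rfl fun Q hQ => ?_
  rw [ofMul_zpow, map_zsmul, normMap_lc, hf Q (Finsupp.mem_support_iff.mp hQ), zpow_zero, div_one]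

/-- A multiple `n D` of a divisor can be moved away from finitely many points by the `n`-th power
of a function, which does not change the pairing. -/
theorem exists_moved (S : Finset C.ClosedPoint) {D : C.Div} {n : ℕ} {f : C.RatFuncˣ}
    (hf : C.div (Additive.ofMul f) = n • D) :
    ∃ h : C.RatFuncˣ, C.div (Additive.ofMul (f * h ^ n)) = n • (D + C.div (Additive.ofMul h)) ∧
      ∀ Q ∈ S, (D + C.div (Additive.ofMul h)) Q = 0 ∧ C.ord Q (f * h ^ n) = 0 := by
  obtain ⟨h, hh⟩ := exists_ord_eq S fun Q => -D Q
  have hdiv : C.div (Additive.ofMul (f * h ^ n)) = n • (D + C.div (Additive.ofMul h)) := by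
    rw [ofMul_mul, ofMul_pow, map_add, map_nsmul, hf, smul_add]
  have h0 (Q : C.ClosedPoint) (hQ : Q ∈ S) : (D + C.div (Additive.ofMul h)) Q = 0 := by
    rw [Finsupp.add_apply, div_apply, hh Q hQ, add_neg_cancel]
  refine ⟨h, hdiv, fun Q hQ => ⟨h0 Q hQ, ?_⟩⟩
  rw [← div_apply, hdiv, Finsupp.smul_apply, h0 Q hQ, smul_zero]

theorem pairingExpr_mul_pow (hπ : ∀ Q, C.IsUniformizer Q (π Q)) {n : ℕ} (hn : 0 < n)
    (f h : C.RatFuncˣ) (E : C.Div) :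
    C.pairingExpr π n (f * h ^ n) E = C.pairingExpr π n f E := by
  rw [pairingExpr_mul hπ, pairingExpr_pow_self hπ hn, add_zero]

theorem divClass_eq_iff {D D' : C.Div} : C.divClass D = C.divClass D' ↔
    ∃ g : C.RatFuncˣ, D' = D + C.div (Additive.ofMul g) := by
  refine (QuotientAddGroup.eq (s := C.div.range)).trans ⟨?_, ?_⟩
  · rintro ⟨g, hg⟩
    exact ⟨g.toMul, by rw [ofMul_toMul, hg]; abel⟩
  · rintro ⟨g, rfl⟩
    exact ⟨Additive.ofMul g, by abel⟩

/-- The pairing with a divisor of degree zero depends only on the class of the first divisor. -/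
theorem pairingExpr_eq_left {π' : C.ClosedPoint → C.RatFuncˣ}
    (hπ : ∀ Q, C.IsUniformizer Q (π Q)) (hπ' : ∀ Q, C.IsUniformizer Q (π' Q))
    {D D' E : C.Div} (hD : C.divClass D = C.divClass D') (hE : E ∈ C.Div0) {n n' : ℕ}
    (hn : 0 < n) (hn' : 0 < n') {f f' : C.RatFuncˣ} (hf : C.div (Additive.ofMul f) = n • D)
    (hf' : C.div (Additive.ofMul f') = n' • D') :
    C.pairingExpr π n f E = C.pairingExpr π' n' f' E := by
  obtain ⟨g, rfl⟩ := divClass_eq_iff.mp hD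
  obtain ⟨h, hh, hS⟩ := exists_moved E.support hf
  obtain ⟨h', hh', hS'⟩ := exists_moved E.support hf'
  rw [← pairingExpr_mul_pow hπ hn f h, ← pairingExpr_mul_pow hπ' hn' f' h']
  generalize f * h ^ n = F at *
  generalize f' * h' ^ n' = F' at *
  have hS1 (Q : C.ClosedPoint) (hQ : E Q ≠ 0) : C.ord Q F = 0 :=
    (hS Q (Finsupp.mem_support_iff.mpr hQ)).2
  have hS1' (Q : C.ClosedPoint) (hQ : E Q ≠ 0) : C.ord Q F' = 0 :=
    (hS' Q (Finsupp.mem_support_iff.mpr hQ)).2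
  rw [pairingExpr_eq_tmulInv _ _ hS1, pairingExpr_eq_tmulInv _ _ hS1']
  -- The two moved divisors differ by the divisor of `w`, whose support is disjoint from that of `E`.
  let w : C.RatFuncˣ := g * h' / h
  have hw : C.div (Additive.ofMul w) = (D + C.div (Additive.ofMul g) + C.div (Additive.ofMul h')) -
      (D + C.div (Additive.ofMul h)) := by
    rw [ofMul_div, ofMul_mul, map_sub, map_add]
    abel
  have hw0 (Q : C.ClosedPoint) (hQ : E Q ≠ 0) : C.ord Q w = 0 := by
    rw [← div_apply, hw, Finsupp.sub_apply, (hS Q (Finsupp.mem_support_iff.mpr hQ)).1,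
      (hS' Q (Finsupp.mem_support_iff.mpr hQ)).1, sub_zero]
  let c : C.RatFuncˣ := F' ^ n * (F ^ n' * w ^ (n * n'))⁻¹
  have hc : C.div (Additive.ofMul c) = 0 := by
    rw [ofMul_mul, ofMul_inv, ofMul_mul, ofMul_pow, ofMul_pow, ofMul_pow, map_add, map_neg, map_add,
      map_nsmul, map_nsmul, map_nsmul, hh, hh', hw, smul_smul, smul_smul, smul_sub, mul_comm n' n]
    abel
  have hpow {u : C.RatFuncˣ} (hu : ∀ Q, E Q ≠ 0 → C.ord Q u = 0) (m : ℕ) (Q : C.ClosedPoint)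
      (hQ : E Q ≠ 0) : C.ord Q (u ^ m) = 0 := by
    rw [ord_pow, hu Q hQ, mul_zero]
  have hmul {u v : C.RatFuncˣ} (hu : ∀ Q, E Q ≠ 0 → C.ord Q u = 0)
      (hv : ∀ Q, E Q ≠ 0 → C.ord Q v = 0) (Q : C.ClosedPoint)
      (hQ : E Q ≠ 0) : C.ord Q (u * v) = 0 := by
    rw [ord_mul, hu Q hQ, hv Q hQ, add_zero]
  have hden := hmul (hpow hS1 n') (hpow hw0 (n * n'))
  have he := evalDiv_eq_one_of_div_eq_zero hc hE
  rw [evalDiv_mul (hpow hS1' n) (fun Q hQ => by rw [ord_inv, hden Q hQ, neg_zero]),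
    evalDiv_inv hden, mul_inv_eq_one, evalDiv_mul (hpow hS1 n') (hpow hw0 _), evalDiv_pow hS1',
    evalDiv_pow hS1, evalDiv_pow hw0] at he
  have hnn : 0 < n * n' := Nat.mul_pos hn hn'
  have h1 := congr_arg (fun u => tmulInv (n * n') (Additive.ofMul u)) he
  simp only [ofMul_mul, ofMul_pow, map_add, map_nsmul] at h1
  rw [nsmul_tmulInv_self hnn, add_zero, nsmul_tmulInv_mul hn', mul_comm n n',
    nsmul_tmulInv_mul hn] at h1
  exact h1.symm

/-- The pairing with a principal divisor is trivial. -/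
theorem pairingExpr_div (hπ : ∀ Q, C.IsUniformizer Q (π Q)) {D : C.Div} {n : ℕ} (hn : 0 < n)
    {f : C.RatFuncˣ} (hf : C.div (Additive.ofMul f) = n • D) (g : C.RatFuncˣ) :
    C.pairingExpr π n f (C.div (Additive.ofMul g)) = 0 := by
  obtain ⟨h, hh, hS⟩ := exists_moved (C.div (Additive.ofMul g)).support hf
  rw [← pairingExpr_mul_pow hπ hn f h]
  have hS1 (Q : C.ClosedPoint) (hQ : C.div (Additive.ofMul g) Q ≠ 0) : C.ord Q (f * h ^ n) = 0 :=
    (hS Q (Finsupp.mem_support_iff.mpr hQ)).2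
  rw [pairingExpr_eq_tmulInv _ _ hS1, evalDiv_div_comm (f := f * h ^ n) (g := g) hS1, hh, evalDiv_nsmul,
    tmulInv_pow_self hn]

/-- The pairing depends only on the classes of the two divisors. -/
theorem pairingExpr_eq {π' : C.ClosedPoint → C.RatFuncˣ}
    (hπ : ∀ Q, C.IsUniformizer Q (π Q)) (hπ' : ∀ Q, C.IsUniformizer Q (π' Q))
    {D D' E E' : C.Div} (hD : C.divClass D = C.divClass D') (hEE' : C.divClass E = C.divClass E')
    (hE : E ∈ C.Div0) {n n' : ℕ} (hn : 0 < n) (hn' : 0 < n') {f f' : C.RatFuncˣ}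
    (hf : C.div (Additive.ofMul f) = n • D) (hf' : C.div (Additive.ofMul f') = n' • D') :
    C.pairingExpr π n f E = C.pairingExpr π' n' f' E' := by
  obtain ⟨g, rfl⟩ := divClass_eq_iff.mp hEE'
  rw [pairingExpr_add, pairingExpr_div hπ' hn' hf', add_zero]
  exact pairingExpr_eq_left hπ hπ' hD hE hn hn' hf hf'

theorem exists_div_eq_nsmul_of_mem_picTors {D : C.Div} (hD : C.divClass D ∈ C.PicTors) :
    ∃ (n : ℕ) (f : C.RatFuncˣ), 0 < n ∧ C.div (Additive.ofMul f) = n • D := by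
  obtain ⟨n, hn, hD⟩ := isOfFinAddOrder_iff_nsmul_eq_zero.mp hD
  rw [← map_nsmul, ← map_zero C.divClass, eq_comm, divClass_eq_iff] at hD
  obtain ⟨f, hf⟩ := hD
  exact ⟨n, f, hn, by rw [hf, zero_add]⟩

theorem mem_div0_of_nsmul_eq_div {D : C.Div} {n : ℕ} (hn : 0 < n) {f : C.RatFuncˣ}
    (hf : C.div (Additive.ofMul f) = n • D) : D ∈ C.Div0 := by
  have h := deg_div f
  rw [hf, map_nsmul, smul_eq_zero] at h
  exact h.resolve_left hn.ne'

/-- Symmetry of the pairing, for representatives. -/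
theorem pairingExpr_symm (hπ : ∀ Q, C.IsUniformizer Q (π Q)) {D E : C.Div} {n m : ℕ} (hn : 0 < n)
    (hm : 0 < m) {f g : C.RatFuncˣ} (hf : C.div (Additive.ofMul f) = n • D)
    (hg : C.div (Additive.ofMul g) = m • E) :
    C.pairingExpr π n f E = C.pairingExpr π m g D := by
  have hD := mem_div0_of_nsmul_eq_div hn hf
  have hE := mem_div0_of_nsmul_eq_div hm hg
  have hN : 0 < n * m := Nat.mul_pos hn hm
  have hF : C.div (Additive.ofMul (f ^ m)) = (n * m) • D := by
    rw [ofMul_pow, map_nsmul, hf, smul_smul, mul_comm]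
  have hG : C.div (Additive.ofMul (g ^ n)) = (n * m) • E := by
    rw [ofMul_pow, map_nsmul, hg, smul_smul]
  rw [pairingExpr_eq_left hπ hπ rfl hE hn hN hf hF, pairingExpr_eq_left hπ hπ rfl hD hm hN hg hG]
  -- With the common multiple `N = n * m`, the divisors of `F` and `G` are `N D` and `N E`.
  generalize f ^ m = F at *
  generalize g ^ n = G at *
  generalize n * m = N at *
  -- `D` can be moved away from the support of `E`, in its class.
  obtain ⟨h, hh, hS⟩ := exists_moved E.support hF
  rw [← pairingExpr_mul_pow hπ hN F h, pairingExpr_eq hπ hπ rfl (divClass_eq_iff.mpr ⟨h, rfl⟩) hD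
    hN hN hG hG]
  generalize F * h ^ N = F at *
  have h1 (Q : C.ClosedPoint) (hQ : E Q ≠ 0) :
      (D + C.div (Additive.ofMul h)) Q = 0 ∧ C.ord Q F = 0 :=
    hS Q (Finsupp.mem_support_iff.mpr hQ)
  generalize D + C.div (Additive.ofMul h) = D at *
  have h2 (Q : C.ClosedPoint) (hQ : D Q ≠ 0) : C.ord Q G = 0 := by
    rw [← div_apply, hG, Finsupp.smul_apply]
    by_contra h
    exact hQ (h1 Q fun h' => h (by rw [h', smul_zero])).1
  have h3 (Q : C.ClosedPoint) (hQ : C.ord Q G ≠ 0) : C.ord Q F = 0 := by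
    rw [← div_apply, hG, Finsupp.smul_apply] at hQ
    exact (h1 Q fun h' => hQ (by rw [h', smul_zero])).2
  -- `F(E) ⊗ 1/N = F(N E) ⊗ 1/N² = F(div G) ⊗ 1/N²`, and likewise for `G(D)`.
  rw [pairingExpr_eq_tmulInv _ _ fun Q hQ => (h1 Q hQ).2, pairingExpr_eq_tmulInv _ _ h2,
    ← tmulInv_mul_pow hN, ← tmulInv_mul_pow hN (evalDiv G D), ← evalDiv_nsmul, ← evalDiv_nsmul,
    ← hG, ← hh, evalDiv_div_comm h3]

theorem picTors_le_pic0 : C.PicTors ≤ C.Pic0 := by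
  intro a ha
  obtain ⟨D, rfl⟩ := QuotientAddGroup.mk'_surjective C.div.range a
  obtain ⟨n, f, hn, hf⟩ := exists_div_eq_nsmul_of_mem_picTors (D := D) ha
  exact AddSubgroup.mem_map_of_mem C.divClass (mem_div0_of_nsmul_eq_div hn hf)

variable (C) in
/-- The value at two classes is computed with chosen representatives; additivity holds since the
expression depends only on classes. -/
theorem exists_isInducedPairing :
    ∃ B : C.PicTors →+ C.Pic0 →+ UnitsQModZ k, C.IsInducedPairing B := by
  choose π hπ using exists_isUniformizer (C := C)
  have hrep (a : C.PicTors) : ∃ (D : C.Div) (n : ℕ) (f : C.RatFuncˣ), C.divClass D = a ∧ 0 < n ∧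
      C.div (Additive.ofMul f) = n • D := by
    obtain ⟨a, ha⟩ := a
    obtain ⟨D, rfl⟩ := QuotientAddGroup.mk'_surjective C.div.range a
    obtain ⟨n, f, hn, hf⟩ := exists_div_eq_nsmul_of_mem_picTors (D := D) ha
    exact ⟨D, n, f, rfl, hn, hf⟩
  choose D n f hD hn hf using hrep
  have hrep' (b : C.Pic0) : ∃ E : C.Div, E ∈ C.Div0 ∧ C.divClass E = b := b.2
  choose E hE hE' using hrep'
  let B₁ (a : C.PicTors) : C.Pic0 →+ UnitsQModZ k := AddMonoidHom.mk'
    (fun b => C.pairingExpr π (n a) (f a) (E b)) fun b c => by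
      rw [← pairingExpr_add]
      refine pairingExpr_eq hπ hπ rfl ?_ (hE _) (hn a) (hn a) (hf a) (hf a)
      rw [map_add, hE', hE', hE', AddSubgroup.coe_add]
  refine ⟨AddMonoidHom.mk' B₁ fun a b => ?_, fun D' E' hD' hE'' m g π' hm hg hπ' => ?_⟩
  · ext c
    change C.pairingExpr π (n (a + b)) (f (a + b)) (E c) =
      C.pairingExpr π (n a) (f a) (E c) + C.pairingExpr π (n b) (f b) (E c)
    have ha : C.div (Additive.ofMul (f a ^ n b)) = (n a * n b) • D a := by
      rw [ofMul_pow, map_nsmul, hf, smul_smul, mul_comm]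
    have hb : C.div (Additive.ofMul (f b ^ n a)) = (n a * n b) • D b := by
      rw [ofMul_pow, map_nsmul, hf, smul_smul]
    have hN : 0 < n a * n b := Nat.mul_pos (hn a) (hn b)
    rw [pairingExpr_eq hπ hπ rfl rfl (hE c) (hn a) hN (hf a) ha,
      pairingExpr_eq hπ hπ rfl rfl (hE c) (hn b) hN (hf b) hb, ← pairingExpr_mul hπ]
    refine pairingExpr_eq hπ hπ (D' := D a + D b) ?_ rfl (hE c) (hn _) hN (hf _) ?_
    · rw [map_add, hD, hD, hD, AddSubgroup.coe_add]
    · rw [ofMul_mul, map_add, ha, hb, smul_add]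
  · exact pairingExpr_eq hπ hπ' (hD _) (hE' _) (hE _) (hn _) hm (hf _) hg

end SmoothProperCurve

theorem mainTheorem2 {k : Type u} [Field k] (C : SmoothProperCurve k) :
    -- principal divisors have degree zero, and there are uniformizers at all closed points
    (∀ f : C.RatFuncˣ, C.deg (C.div (Additive.ofMul f)) = 0) ∧
    (∀ Q : C.ClosedPoint, ∃ π : C.RatFuncˣ, C.IsUniformizer Q π) ∧
    -- the leading coefficient expression depends only on the classes of `D` and `E`
    (∀ (D D' E E' : C.Div) (n n' : ℕ) (f f' : C.RatFuncˣ) (π π' : C.ClosedPoint → C.RatFuncˣ),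
      C.divClass D = C.divClass D' → C.divClass E = C.divClass E' →
      E ∈ C.Div0 → E' ∈ C.Div0 → 0 < n → 0 < n' →
      C.div (Additive.ofMul f) = n • D → C.div (Additive.ofMul f') = n' • D' →
      (∀ Q, C.IsUniformizer Q (π Q)) → (∀ Q, C.IsUniformizer Q (π' Q)) →
      C.pairingExpr π n f E = C.pairingExpr π' n' f' E') ∧
    -- it induces a unique biadditive pairing, whose restriction to the torsion is symmetric
    ∃ (h : C.PicTors ≤ C.Pic0) (B : C.PicTors →+ C.Pic0 →+ UnitsQModZ k),
      C.IsInducedPairing B ∧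
      (∀ B' : C.PicTors →+ C.Pic0 →+ UnitsQModZ k, C.IsInducedPairing B' → B' = B) ∧
      ∀ a b : C.PicTors, B a ⟨b, h b.2⟩ = B b ⟨a, h a.2⟩ := by
  choose π hπ using SmoothProperCurve.exists_isUniformizer (C := C)
  obtain ⟨B, hB⟩ := C.exists_isInducedPairing
  refine ⟨SmoothProperCurve.deg_div, SmoothProperCurve.exists_isUniformizer, ?_,
    SmoothProperCurve.picTors_le_pic0, B, hB, fun B' hB' => ?_, ?_⟩
  · intro D D' E E' n n' f f' π π' hD hE hE0 _ hn hn' hf hf' hπ hπ'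
    exact SmoothProperCurve.pairingExpr_eq hπ hπ' hD hE hE0 hn hn' hf hf'
  · ext ⟨a, ha⟩ ⟨_, E, hE, rfl⟩
    obtain ⟨D, rfl⟩ := QuotientAddGroup.mk'_surjective C.div.range a
    obtain ⟨n, f, hn, hf⟩ := SmoothProperCurve.exists_div_eq_nsmul_of_mem_picTors (D := D) ha
    exact (hB' D E ha hE n f π hn hf hπ).trans (hB D E ha hE n f π hn hf hπ).symm
  · rintro ⟨a, ha⟩ ⟨b, hb⟩
    obtain ⟨D, rfl⟩ := QuotientAddGroup.mk'_surjective C.div.range a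
    obtain ⟨E, rfl⟩ := QuotientAddGroup.mk'_surjective C.div.range b
    obtain ⟨n, f, hn, hf⟩ := SmoothProperCurve.exists_div_eq_nsmul_of_mem_picTors (D := D) ha
    obtain ⟨m, g, hm, hg⟩ := SmoothProperCurve.exists_div_eq_nsmul_of_mem_picTors (D := E) hb
    exact (hB D E ha (SmoothProperCurve.mem_div0_of_nsmul_eq_div hm hg) n f π hn hf hπ).trans
      ((SmoothProperCurve.pairingExpr_symm hπ hn hm hf hg).trans
        (hB E D hb (SmoothProperCurve.mem_div0_of_nsmul_eq_div hn hf) m g π hm hg hπ).symm)
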